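/- Let $(A,\mathfrak m)$ be a one-dimensional (Noetherian) Cohen-Macaulay local ring with infinite residue field, let $xA$ be a minimal reduction of $\mathfrak m$, and let $r$ be the reduction number of $\mathfrak m$ with respect to $xA$, i.e. the least integer $r\ge 0$ with $\mathfrak m^{r+1}=x\mathfrak m^r$. Write $\lambda$ for the length of an $A$-module. Let $G(\mathfrak m)=\bigoplus_{n\ge 0}\mathfrak m^n/\mathfrak m^{n+1}$ be the tangent cone, regarded as a graded module over $F(x)=\bigoplus_{n\ge 0}x^nA/x^n\mathfrak m$ through the natural homomorphism $F(x)\to G(\mathfrak m)$, and let $x^*\in F(x)$ be the class of $x$ in $xA/x\mathfrak m$. Then there are non-negative integers $\alpha_i$ ($0\le i\le r$) and $\alpha_{i,j}$ ($1\le i\le r-1$, $1\le j\le r-i$) and an isomorphism of graded $F(x)$-modules $$G(\mathfrak m)\cong\bigoplus_{i=0}^{r}\bigl(F(x)(-i)\bigr)^{\alpha_i}\oplus\bigoplus_{i=1}^{r-1}\bigoplus_{j=1}^{r-i}\left(\frac{F(x)}{(x^*)^jF(x)}(-i)\right)^{\alpha_{i,j}},$$ and for all numbers $\alpha_i,\alpha_{i,j}$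 for which such an isomorphism exists, and for every $1\le i\le r$, $$\alpha_i+\sum_{j=1}^{r-i-1}\alpha_{i,j}=\gamma_i+\lambda\left(\frac{\mathfrak m^i\cap xA+\mathfrak m^{i+1}}{x\mathfrak m^{i-1}+\mathfrak m^{i+1}}\right),\qquad\text{where}\quad \gamma_i=\lambda\left(\frac{\mathfrak m^i+xA}{\mathfrak m^{i+1}+xA}\right),$$ an empty sum being $0$. In particular all these lengths are finite. -/

import Mathlib

open IsLocalRing
open scoped DirectSum

noncomputable section

/-- The length `λ(I / J)` of the quotient of the ideal `I` by the ideal `J` (meant for `J ≤ I`),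
as an extended natural number. -/
def quotLength {A : Type*} [CommRing A] (I J : Ideal A) : ℕ∞ :=
  Module.length A (↥I ⧸ J.submoduleOf I)

/-- A Noetherian local ring is Cohen-Macaulay if its maximal ideal contains a regular sequence
whose length is the Krull dimension. -/
def IsCohenMacaulayLocal (A : Type*) [CommRing A] [IsLocalRing A] : Prop :=
  ∃ rs : List A, (∀ a ∈ rs, a ∈ maximalIdeal A) ∧ RingTheory.Sequence.IsRegular A rs ∧
    (rs.length : WithBot ℕ∞) = ringKrullDim A

/-- `J` is a reduction of `I`. -/
def IsReduction {A : Type*} [CommRing A] (I J : Ideal A) : Prop :=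
  J ≤ I ∧ ∃ n : ℕ, I ^ (n + 1) = J * I ^ n

/-- `J` is a minimal reduction of `I`: a reduction that contains no smaller reduction of `I`. -/
def IsMinimalReduction {A : Type*} [CommRing A] (I J : Ideal A) : Prop :=
  Minimal (IsReduction I) J

/-- The reduction number of `I` with respect to a reduction `J`. -/
def reductionNumber {A : Type*} [CommRing A] (I J : Ideal A) : ℕ :=
  sInf {n : ℕ | I ^ (n + 1) = J * I ^ n}

section FiberCone

variable {A : Type*} [CommRing A] [IsLocalRing A]

/-- The degree `n` part `I ^ n / 𝔪 I ^ n` of the fiber cone of `I`. For `I = 𝔪` this is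
`𝔪 ^ n / 𝔪 ^ (n + 1)`, for `I = xA` it is `x ^ n A / x ^ n 𝔪`. -/
abbrev FiberPiece (I : Ideal A) (n : ℕ) : Type _ :=
  ↥(I ^ n) ⧸ (maximalIdeal A * I ^ n).submoduleOf (I ^ n)

namespace FiberPiece

/-- The class of an element of `I ^ n` in `I ^ n / 𝔪 I ^ n`. -/
abbrev mk (I : Ideal A) (n : ℕ) (a : ↥(I ^ n)) : FiberPiece I n :=
  Submodule.Quotient.mk a

/-- Multiplication `I ^ i × I ^ j → I ^ (i + j)`. -/
def preMul (I : Ideal A) (i j : ℕ) : ↥(I ^ i) →ₗ[A] ↥(I ^ j) →ₗ[A] ↥(I ^ (i + j)) :=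
  LinearMap.mk₂ A (fun a b => ⟨a.1 * b.1, by rw [pow_add]; exact Ideal.mul_mem_mul a.2 b.2⟩)
    (fun a b c => Subtype.ext (add_mul _ _ _))
    (fun r a b => Subtype.ext (smul_mul_assoc r a.1 b.1))
    (fun a b c => Subtype.ext (mul_add _ _ _))
    (fun r a b => Subtype.ext (mul_smul_comm r a.1 b.1))

/-- Multiplication of homogeneous elements of the fiber cone, `[a] * [b] = [a * b]`. -/
def mul (I : Ideal A) (i j : ℕ) :
    FiberPiece I i →ₗ[A] FiberPiece I j →ₗ[A] FiberPiece I (i + j) :=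
  Submodule.liftQ _
    (LinearMap.flip (Submodule.liftQ _
      (LinearMap.flip ((preMul I i j).compr₂
        ((maximalIdeal A * I ^ (i + j)).submoduleOf (I ^ (i + j))).mkQ))
      (by
        intro b hb
        rw [LinearMap.mem_ker]
        ext a
        refine (Submodule.Quotient.mk_eq_zero _).2 ?_
        change a.1 * b.1 ∈ maximalIdeal A * I ^ (i + j)
        rw [pow_add, mul_left_comm]
        exact Ideal.mul_mem_mul a.2 hb)))
    (by
      intro a ha
      rw [LinearMap.mem_ker]
      ext b
      refine (Submodule.Quotient.mk_eq_zero _).2 ?_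
      change a.1 * b.1 ∈ maximalIdeal A * I ^ (i + j)
      rw [pow_add, ← mul_assoc]
      exact Ideal.mul_mem_mul ha b.2)

theorem mul_mk_mk (I : Ideal A) (i j : ℕ) (a : ↥(I ^ i)) (b : ↥(I ^ j)) :
    mul I i j (mk I i a) (mk I j b) =
      mk I (i + j) ⟨a.1 * b.1, by rw [pow_add]; exact Ideal.mul_mem_mul a.2 b.2⟩ := rfl

theorem gradedMk_eq (I : Ideal A) {i j : ℕ} (h : i = j) (a : ↥(I ^ i)) (b : ↥(I ^ j))
    (hab : a.1 = b.1) :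
    GradedMonoid.mk (A := FiberPiece I) i (mk I i a) = GradedMonoid.mk j (mk I j b) := by
  subst h
  rw [Subtype.ext hab]

instance gMul (I : Ideal A) : GradedMonoid.GMul (FiberPiece I) where
  mul {i j} a b := mul I i j a b

instance gOne (I : Ideal A) : GradedMonoid.GOne (FiberPiece I) where
  one := mk I 0 ⟨1, by simp⟩

instance gCommRing (I : Ideal A) : DirectSum.GCommRing (FiberPiece I) where
  __ := gMul I
  __ := gOne I
  mul_zero {i j} a := map_zero (mul I i j a)
  zero_mul {i j} b := (mul I i j).map_zero₂ b
  mul_add {i j} a b c := map_add (mul I i j a) b c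
  add_mul {i j} a b c := (mul I i j).map_add₂ a b c
  one_mul := by
    rintro ⟨i, a⟩
    induction a using Submodule.Quotient.induction_on with
    | H a => exact gradedMk_eq I (zero_add i) _ _ (one_mul a.1)
  mul_one := by
    rintro ⟨i, a⟩
    induction a using Submodule.Quotient.induction_on with
    | H a => exact gradedMk_eq I (add_zero i) _ _ (mul_one a.1)
  mul_assoc := by
    rintro ⟨i, a⟩ ⟨j, b⟩ ⟨k, c⟩
    induction a using Submodule.Quotient.induction_on with
    | H a =>
      induction b using Submodule.Quotient.induction_on with
      | H b =>
        induction c using Submodule.Quotient.induction_on with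
        | H c => exact gradedMk_eq I (add_assoc i j k) _ _ (mul_assoc a.1 b.1 c.1)
  mul_comm := by
    rintro ⟨i, a⟩ ⟨j, b⟩
    induction a using Submodule.Quotient.induction_on with
    | H a =>
      induction b using Submodule.Quotient.induction_on with
      | H b => exact gradedMk_eq I (add_comm i j) _ _ (mul_comm a.1 b.1)
  natCast n := mk I 0 ⟨(n : A), by simp⟩
  natCast_zero := congrArg (mk I 0) (Subtype.ext Nat.cast_zero)
  natCast_succ n := congrArg (mk I 0) (Subtype.ext (Nat.cast_succ n))
  intCast n := mk I 0 ⟨(n : A), by simp⟩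
  intCast_ofNat n := congrArg (mk I 0) (Subtype.ext (Int.cast_natCast n))
  intCast_negSucc_ofNat n := congrArg (mk I 0) (Subtype.ext (Int.cast_negSucc n))

/-- The map `J ^ n / 𝔪 J ^ n → I ^ n / 𝔪 I ^ n` induced by an inclusion `J ≤ I`. -/
def incl {J I : Ideal A} (h : J ≤ I) (n : ℕ) : FiberPiece J n →ₗ[A] FiberPiece I n :=
  Submodule.mapQ _ _ (Submodule.inclusion (Ideal.pow_right_mono h n))
    (fun _ ha => Ideal.mul_mono_right (Ideal.pow_right_mono h n) ha)

end FiberPiece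

/-- The fiber cone `⨁ₙ I ^ n / 𝔪 I ^ n` of an ideal `I`, a graded commutative ring with
multiplication `[a] * [b] = [a * b]`. -/
def FiberCone (I : Ideal A) : Type _ := ⨁ n : ℕ, FiberPiece I n

instance FiberCone.commRing (I : Ideal A) : CommRing (FiberCone I) :=
  inferInstanceAs (CommRing (⨁ n : ℕ, FiberPiece I n))

/-- The inclusion of the degree `n` part `I ^ n / 𝔪 I ^ n` into the fiber cone. -/
def FiberCone.of (I : Ideal A) (n : ℕ) : FiberPiece I n →+ FiberCone I :=
  DirectSum.of (FiberPiece I) n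

theorem FiberCone.of_mul_of (I : Ideal A) (i j : ℕ) (a : FiberPiece I i) (b : FiberPiece I j) :
    FiberCone.of I i a * FiberCone.of I j b = FiberCone.of I (i + j) (FiberPiece.mul I i j a b) :=
  DirectSum.of_mul_of a b

variable (A) in
/-- The tangent cone `G(𝔪) = ⨁ₙ 𝔪 ^ n / 𝔪 ^ (n + 1)`. -/
abbrev TangentCone : Type _ := FiberCone (maximalIdeal A)

/-- The homogeneous elements of degree `n` of the fiber cone. -/
def FiberCone.degree (I : Ideal A) (n : ℕ) : AddSubgroup (FiberCone I) :=
  (FiberCone.of I n).range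

/-- The graded ring homomorphism of fiber cones induced by an inclusion of ideals. -/
def FiberCone.map {J I : Ideal A} (h : J ≤ I) : FiberCone J →+* FiberCone I :=
  DirectSum.toSemiring
    (fun n => (FiberCone.of I n).comp (FiberPiece.incl h n).toAddMonoidHom)
    rfl
    (by
      intro i j a b
      induction a using Submodule.Quotient.induction_on with
      | H a =>
        induction b using Submodule.Quotient.induction_on with
        | H b =>
          exact (FiberCone.of_mul_of I i j (FiberPiece.incl h i (FiberPiece.mk J i a))
            (FiberPiece.incl h j (FiberPiece.mk J j b))).symm)

/-- The ring `F(x) = ⨁ₙ x ^ n A / x ^ n 𝔪`. -/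
abbrev NoetherNormalization (x : A) : Type _ := FiberCone (Ideal.span {x})

/-- The class `x* ∈ F(x)` of `x` in `xA / x𝔪`, homogeneous of degree one. -/
def xStar (x : A) : NoetherNormalization x :=
  FiberCone.of (Ideal.span {x}) 1
    (FiberPiece.mk _ 1 ⟨x, by rw [pow_one]; exact Ideal.mem_span_singleton_self x⟩)

/-- The graded cyclic module `F(x) / (x*) ^ j F(x)`. -/
abbrev CyclicTorsion (x : A) (j : ℕ) : Type _ :=
  NoetherNormalization x ⧸ Ideal.span {xStar x ^ j}

/-- The degree `n` part of the shifted module `F(x)(-i)`, that is, the degree `n - i` part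
of `F(x)`, which is zero for `n < i`. -/
def freeDegree (x : A) (i n : ℕ) : AddSubgroup (NoetherNormalization x) :=
  if i ≤ n then FiberCone.degree (Ideal.span {x}) (n - i) else ⊥

/-- The degree `n` part of the shifted module `(F(x) / (x*) ^ j F(x))(-i)`. -/
def torsionDegree (x : A) (i j n : ℕ) : AddSubgroup (CyclicTorsion x j) :=
  (freeDegree x i n).map (Ideal.Quotient.mk (Ideal.span {xStar x ^ j})).toAddMonoidHom

/-- Index set of the free summands: `α i` copies for each `0 ≤ i ≤ r`. -/
abbrev FreeIndex (r : ℕ) (α : ℕ → ℕ) : Type := Σ i : Fin (r + 1), Fin (α i)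

/-- Index set of the torsion summands: `α' i j` copies for each `1 ≤ i ≤ r - 1` and
`1 ≤ j ≤ r - i`. -/
abbrev TorsionIndex (r : ℕ) (α' : ℕ → ℕ → ℕ) : Type :=
  Σ p : {p : ℕ × ℕ // (1 ≤ p.1 ∧ p.1 ≤ r - 1) ∧ (1 ≤ p.2 ∧ p.2 ≤ r - p.1)}, Fin (α' p.1.1 p.1.2)

/-- The `F(x)`-module `⨁_i (F(x)(-i))^(α i) ⊕ ⨁_{i,j} ((F(x) / (x*) ^ j F(x))(-i))^(α' i j)`.
Both index sets are finite, so the direct sums are written as products. -/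
abbrev StandardModule (x : A) (r : ℕ) (α : ℕ → ℕ) (α' : ℕ → ℕ → ℕ) : Type _ :=
  (FreeIndex r α → NoetherNormalization x) × ((t : TorsionIndex r α') → CyclicTorsion x t.1.1.2)

/-- `y` is homogeneous of degree `n` for the grading of `StandardModule` with the shifts. -/
def StandardModule.IsHomogeneous (x : A) (r : ℕ) (α : ℕ → ℕ) (α' : ℕ → ℕ → ℕ) (n : ℕ)
    (y : StandardModule x r α α') : Prop :=
  (∀ s : FreeIndex r α, y.1 s ∈ freeDegree x s.1 n) ∧
    ∀ t : TorsionIndex r α', y.2 t ∈ torsionDegree x t.1.1.1 t.1.1.2 n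

/-- The numbers `α i` (`0 ≤ i ≤ r`) and `α' i j` (`1 ≤ i ≤ r - 1`, `1 ≤ j ≤ r - i`) are
invariants of the tangent cone with respect to `x ∈ 𝔪`, where `r` is the reduction number: there
is an isomorphism of graded `F(x)`-modules
`G(𝔪) ≅ ⨁_i (F(x)(-i))^(α i) ⊕ ⨁_{i,j} ((F(x) / (x*) ^ j F(x))(-i))^(α' i j)`, where `F(x)` acts
on `G(𝔪)` through the natural homomorphism `F(x) → G(𝔪)`. -/
def IsTangentConeInvariants (x : A) (hx : Ideal.span {x} ≤ maximalIdeal A)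
    (α : ℕ → ℕ) (α' : ℕ → ℕ → ℕ) : Prop :=
  let r := reductionNumber (maximalIdeal A) (Ideal.span {x})
  ∃ φ : TangentCone A ≃+ StandardModule x r α α',
    (∀ (f : NoetherNormalization x) (g : TangentCone A), φ (FiberCone.map hx f * g) = f • φ g) ∧
    ∀ (n : ℕ) (g : TangentCone A),
      g ∈ FiberCone.degree (maximalIdeal A) n ↔
        StandardModule.IsHomogeneous x r α α' n (φ g)

end FiberCone

/-- The Apery invariant `γ_i = λ((𝔪 ^ i + xA) / (𝔪 ^ (i + 1) + xA))` with respect to `x`. -/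
def aperyInvariant {A : Type*} [CommRing A] [IsLocalRing A] (x : A) (i : ℕ) : ℕ∞ :=
  quotLength (maximalIdeal A ^ i ⊔ Ideal.span {x}) (maximalIdeal A ^ (i + 1) ⊔ Ideal.span {x})

end

/-! Let `k` be the residue field. Since `x` is a nonzerodivisor, `F(x)` is the polynomial ring
`k[X]` with `X = x*`. So `G(𝔪)` is a graded `k`-space with finite-dimensional pieces `V n` and an
endomorphism `T` of degree one, multiplication by the class of `x` in `𝔪/𝔪²`. The required
isomorphisms are the same as decompositions into homogeneous cyclic `k[X]`-modules
(`exists_iso_iff_exists_isCyclicDecomposition`). From `𝔪^(r+1) = x𝔪^r` it follows that `T` maps `V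
n` onto `V (n+1)` for `n ≥ r` and is injective on `V n` for `n ≥ r - 1`. No power of `T` kills a
nonzero element of `V 0`, because `x^j ∉ 𝔪^(j+1)`.

Existence: filter `V i` by the degree `e` in which an element has died (`liveKer`). In each step
choose a complement (`newKer`) to what dies earlier or comes from `T (V (i-1))`. Bases of these
complements are the generators: `e ≤ r` gives `k[X]/(X^(e-i))`, and `e = r+1` gives a free summand.
Independence (`newKer_independent`) compares the largest death degrees; spanning is an induction on
degree and `e`. Beyond degree `r` everything is transported by the bijection `T`.

Formula: in any decomposition all annihilators are divisible by `X`. Hence the number of generators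
of degree `i` is `dim V i / T (V (i-1)) = λ(𝔪^i / (x𝔪^(i-1) + 𝔪^(i+1)))` (`quotLength_eq_card`).
Inserting `(𝔪^i ∩ xA) + 𝔪^(i+1)` splits this length into `γ_i` and the second term of the formula
(`aperyInvariant_add_eq`). On the other side the count is `α_i` plus the `α_{i,j}` with `j ≤ r - i`,
and `α_{i,r-i} = 0`: such a generator would give a nonzero element of degree `r - 1` killed by `T`
(`IsCyclicDecomposition.ne_of_injective`). -/

open IsLocalRing
open scoped DirectSum

noncomputable section

/-! ### Decomposing a graded vector space with an endomorphism of degree one. -/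

section GradedEndomorphism

open Polynomial

variable {k E : Type*} [Field k] [AddCommGroup E] [Module k E]

/-- The elements of `V i` killed by `T ^ (e - i)` if `e ≤ r`, and all of `V i` if `r < e`. -/
def liveKer (T : Module.End k E) (V : ℕ → Submodule k E) (r i e : ℕ) : Submodule k E :=
  if e ≤ r then V i ⊓ LinearMap.ker (T ^ (e - i)) else V i

/-- The image of the piece of degree `i - 1` in degree `i`. -/
def prevImage (T : Module.End k E) (V : ℕ → Submodule k E) : ℕ → Submodule k E
  | 0 => ⊥
  | i + 1 => (V i).map T

variable {T : Module.End k E} {V : ℕ → Submodule k E} {r : ℕ}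

theorem liveKer_le (i e : ℕ) : liveKer T V r i e ≤ V i := by
  unfold liveKer
  split_ifs
  · exact inf_le_left
  · exact le_rfl

theorem pow_apply_eq_zero_of_le {a b : ℕ} (h : a ≤ b) {v : E} (hv : (T ^ a) v = 0) :
    (T ^ b) v = 0 := by
  obtain ⟨c, rfl⟩ := Nat.exists_eq_add_of_le' h
  rw [pow_add, Module.End.mul_apply, hv, map_zero]

theorem liveKer_mono (i : ℕ) {e e' : ℕ} (h : e ≤ e') :
    liveKer T V r i e ≤ liveKer T V r i e' := by
  intro v hv
  have hV := liveKer_le _ _ hv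
  unfold liveKer at hv ⊢
  split_ifs with h'
  · rw [if_pos (h.trans h')] at hv
    exact ⟨hV, pow_apply_eq_zero_of_le (by omega) hv.2⟩
  · exact hV

theorem liveKer_of_lt {i e : ℕ} (h : r < e) : liveKer T V r i e = V i := by
  simp [liveKer, h]

theorem liveKer_eq_bot {i e : ℕ} (h : e ≤ r) (h' : e ≤ i) : liveKer T V r i e = ⊥ := by
  rw [liveKer, if_pos h, Nat.sub_eq_zero_of_le h', pow_zero, eq_bot_iff]
  exact fun v hv => hv.2

/-- The index `e` is an absolute degree, not an exponent, so it does not change under `T`. -/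
theorem mem_liveKer_of_apply_mem {i e : ℕ} (hie : i + 1 ≤ e) {u : E} (hu : u ∈ V i)
    (h : T u ∈ liveKer T V r (i + 1) e) : u ∈ liveKer T V r i e := by
  unfold liveKer at h ⊢
  split_ifs with h'
  · rw [if_pos h'] at h
    refine ⟨hu, ?_⟩
    have h2 : (T ^ (e - (i + 1))) (T u) = 0 := h.2
    rw [← Module.End.mul_apply, ← pow_succ] at h2
    rwa [SetLike.mem_coe, LinearMap.mem_ker, show e - i = e - (i + 1) + 1 by omega]
  · exact hu

/-- The part of `liveKer T V r i e` that comes from smaller degrees or smaller kernels. -/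
def oldKer (T : Module.End k E) (V : ℕ → Submodule k E) (r i e : ℕ) : Submodule k E :=
  liveKer T V r i (e - 1) ⊔ (liveKer T V r i e ⊓ prevImage T V i)

theorem oldKer_le (i e : ℕ) : oldKer T V r i e ≤ liveKer T V r i e :=
  sup_le (liveKer_mono i (Nat.sub_le e 1)) inf_le_left

variable (T V r) in
/-- A choice of a complement of `oldKer` in `liveKer`. -/
def newKer (i e : ℕ) : Submodule k E :=
  (IsModularLattice.exists_disjoint_and_sup_eq (oldKer_le (T := T) (V := V) (r := r) i e)).choose

theorem disjoint_newKer (i e : ℕ) : Disjoint (oldKer T V r i e) (newKer T V r i e) :=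
  (IsModularLattice.exists_disjoint_and_sup_eq (oldKer_le (T := T) (V := V) (r := r) i e)).choose_spec.1

theorem oldKer_sup_newKer (i e : ℕ) :
    oldKer T V r i e ⊔ newKer T V r i e = liveKer T V r i e :=
  (IsModularLattice.exists_disjoint_and_sup_eq (oldKer_le (T := T) (V := V) (r := r) i e)).choose_spec.2

theorem newKer_le_liveKer (i e : ℕ) : newKer T V r i e ≤ liveKer T V r i e :=
  le_sup_right.trans (oldKer_sup_newKer i e).le

theorem newKer_le (i e : ℕ) : newKer T V r i e ≤ V i :=
  (newKer_le_liveKer i e).trans (liveKer_le i e)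

/-- Let `m > e₀` be the largest index with `w m ≠ 0`. All other terms die by degree `m - 1`, hence
so does `w m + t`. As `t` comes from the previous degree, `w m` lies in `oldKer`, which meets
`newKer` only in zero. -/
theorem newKer_eq_zero_of_sum_mem {n e₀ : ℕ} {D : Finset ℕ} {w : ℕ → E} {t : E}
    (hw : ∀ e, w e ∈ newKer T V r n e) (ht : t ∈ prevImage T V n)
    (h : ∑ e ∈ D, w e + t ∈ liveKer T V r n e₀) {e : ℕ} (heD : e ∈ D) (he : e₀ < e) :
    w e = 0 := by
  classical
  by_contra hne
  obtain ⟨m, hm, hmax⟩ := (D.filter (fun e => e₀ < e ∧ w e ≠ 0)).exists_max_image id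
    ⟨e, by simp [heD, he, hne]⟩
  simp only [Finset.mem_filter, id] at hm hmax
  obtain ⟨hmD, hm0, hmne⟩ := hm
  have hrest : ∑ e ∈ D.erase m, w e ∈ liveKer T V r n (m - 1) := by
    refine Submodule.sum_mem _ fun e he => ?_
    obtain ⟨hem, heD⟩ := Finset.mem_erase.1 he
    by_cases hlt : e < m
    · exact liveKer_mono n (Nat.le_sub_one_of_lt hlt) (newKer_le_liveKer _ _ (hw e))
    · have : w e = 0 := by
        by_contra hn
        have := hmax e ⟨heD, by omega, hn⟩
        omega
      rw [this]
      exact zero_mem _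
  rw [← Finset.add_sum_erase _ _ hmD] at h
  have hall : w m + ∑ e ∈ D.erase m, w e + t ∈ liveKer T V r n (m - 1) :=
    liveKer_mono n (by omega) h
  have hle := liveKer_mono (T := T) (V := V) (r := r) n (Nat.sub_le m 1)
  have htm : t ∈ liveKer T V r n m := by
    have := sub_mem (sub_mem (hle hall) (hle hrest)) (newKer_le_liveKer _ _ (hw m))
    convert this using 1
    abel
  have hold : w m ∈ oldKer T V r n m := by
    have h1 : w m + t ∈ liveKer T V r n (m - 1) := by
      convert sub_mem hall hrest using 1
      abel
    have h1' : w m + t ∈ oldKer T V r n m := Submodule.mem_sup_left h1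
    have h2 : t ∈ oldKer T V r n m :=
      Submodule.mem_sup_right (Submodule.mem_inf.2 ⟨htm, ht⟩)
    exact (Submodule.add_mem_iff_left _ h2).1 h1'
  exact hmne (Submodule.disjoint_def.1 (disjoint_newKer n m) _ hold (hw m))

theorem pow_apply_mem (hT : ∀ n, ∀ v ∈ V n, T v ∈ V (n + 1)) {n : ℕ} (d : ℕ) {v : E}
    (hv : v ∈ V n) : (T ^ d) v ∈ V (n + d) := by
  induction d with
  | zero => simpa using hv
  | succ d ih =>
    rw [pow_succ', Module.End.mul_apply]
    exact hT _ _ ih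

theorem pow_sub_apply_mem (hT : ∀ n, ∀ v ∈ V n, T v ∈ V (n + 1)) {m n : ℕ} (h : m ≤ n) {v : E}
    (hv : v ∈ V m) : (T ^ (n - m)) v ∈ V n := by
  have := pow_apply_mem hT (n - m) hv
  rwa [Nat.add_sub_cancel' h] at this

/-- The part of the sum from degrees below the top one is `T u`. Once the top terms with `e > e₀`
are gone, `T u` is only known to lie in `liveKer` for `e₀`, not to vanish. The statement is
therefore relative to `e₀`, and the induction continues with `u`. -/
theorem newKer_independent (hT : ∀ n, ∀ v ∈ V n, T v ∈ V (n + 1)) {D : Finset ℕ}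
    {w : ℕ → ℕ → E} (hw : ∀ i e, w i e ∈ newKer T V r i e) (n : ℕ) :
    ∀ e₀, n ≤ e₀ →
      ∑ i ∈ Finset.range (n + 1), ∑ e ∈ D, (T ^ (n - i)) (w i e) ∈ liveKer T V r n e₀ →
      ∀ i ≤ n, ∀ e ∈ D, e₀ < e → w i e = 0 := by
  induction n with
  | zero =>
    intro e₀ _ h i hi e he hlt
    obtain rfl := Nat.le_zero.1 hi
    refine newKer_eq_zero_of_sum_mem (D := D) (hw 0) (Submodule.zero_mem (prevImage T V 0)) ?_ he hlt
    simpa using h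
  | succ n ih =>
    intro e₀ hn h
    set u := ∑ i ∈ Finset.range (n + 1), ∑ e ∈ D, (T ^ (n - i)) (w i e) with hu
    have huV : u ∈ V n := by
      refine Submodule.sum_mem _ fun i hi => Submodule.sum_mem _ fun e _ => ?_
      exact pow_sub_apply_mem hT (Nat.lt_succ_iff.1 (Finset.mem_range.1 hi))
        (newKer_le _ _ (hw i e))
    have hsum : ∑ i ∈ Finset.range (n + 1 + 1), ∑ e ∈ D, (T ^ (n + 1 - i)) (w i e) =
        ∑ e ∈ D, w (n + 1) e + T u := by
      rw [Finset.sum_range_succ, add_comm]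
      congr 1
      · simp
      · rw [hu, map_sum]
        refine Finset.sum_congr rfl fun i hi => ?_
        rw [map_sum]
        refine Finset.sum_congr rfl fun e _ => ?_
        have : i < n + 1 := Finset.mem_range.1 hi
        rw [← Module.End.mul_apply, ← pow_succ', show n + 1 - i = n - i + 1 by omega]
    rw [hsum] at h
    have htop : ∀ e ∈ D, e₀ < e → w (n + 1) e = 0 := fun e he hlt =>
      newKer_eq_zero_of_sum_mem (hw (n + 1)) (Submodule.mem_map_of_mem huV) h he hlt
    have hlow : ∑ e ∈ D, w (n + 1) e ∈ liveKer T V r (n + 1) e₀ := by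
      refine Submodule.sum_mem _ fun e he => ?_
      by_cases hlt : e₀ < e
      · rw [htop e he hlt]
        exact zero_mem _
      · exact liveKer_mono _ (by omega) (newKer_le_liveKer _ _ (hw _ e))
    have hTu : T u ∈ liveKer T V r (n + 1) e₀ := (Submodule.add_mem_iff_right _ hlow).1 h
    have hu' := mem_liveKer_of_apply_mem hn huV hTu
    intro i hi e he hlt
    rcases Nat.lt_or_eq_of_le hi with hi' | rfl
    · exact ih e₀ (by omega) hu' i (by omega) e he hlt
    · exact htop e he hlt

/-- Induction on the degree and, inside it, on `e`: `liveKer` is built from the smaller `e`, the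
image of the previous degree and `newKer`. At `e = r + 1` it is all of `V n`. -/
theorem liveKer_le_of_newKer_le {S : Submodule k E} (hS : ∀ v ∈ S, T v ∈ S)
    (hW : ∀ i ≤ r, ∀ e ≤ r + 1, newKer T V r i e ≤ S) (n : ℕ) (hn : n ≤ r) : V n ≤ S := by
  induction n with
  | zero =>
    have key : ∀ e ≤ r + 1, liveKer T V r 0 e ≤ S := by
      intro e
      induction e with
      | zero =>
        intro _
        rw [liveKer_eq_bot (Nat.zero_le _) le_rfl]
        exact bot_le
      | succ e ih =>
        intro he
        rw [← oldKer_sup_newKer]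
        exact sup_le (sup_le (ih (by omega)) (inf_le_right.trans bot_le)) (hW 0 hn _ he)
    rw [← liveKer_of_lt (T := T) (V := V) (Nat.lt_succ_self r)]
    exact key _ le_rfl
  | succ n ihn =>
    have hprev : prevImage T V (n + 1) ≤ S := by
      rintro _ ⟨v, hv, rfl⟩
      exact hS _ (ihn (by omega) hv)
    have key : ∀ e ≤ r + 1, liveKer T V r (n + 1) e ≤ S := by
      intro e
      induction e with
      | zero =>
        intro _
        rw [liveKer_eq_bot (Nat.zero_le _) (Nat.zero_le _)]
        exact bot_le
      | succ e ih =>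
        intro he
        rw [← oldKer_sup_newKer]
        exact sup_le (sup_le (ih (by omega)) (inf_le_right.trans hprev)) (hW _ hn _ he)
    rw [← liveKer_of_lt (T := T) (V := V) (Nat.lt_succ_self r)]
    exact key _ le_rfl

/-- The graded `k[X]`-module `(E, T, V)` is the direct sum of the cyclic modules generated by the
homogeneous elements `g s` of degree `deg s` and with annihilator `(q s)`. -/
structure IsCyclicDecomposition (T : Module.End k E) (V : ℕ → Submodule k E) {ι : Type*}
    [Fintype ι] (deg : ι → ℕ) (q : ι → k[X]) (g : ι → E) : Prop where
  mem : ∀ s, g s ∈ V (deg s)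
  annihilates : ∀ s, aeval T (q s) (g s) = 0
  dvd : ∀ p : ι → k[X], ∑ s, aeval T (p s) (g s) = 0 → ∀ s, q s ∣ p s
  span : ∀ v, ∃ p : ι → k[X], ∑ s, aeval T (p s) (g s) = v

/-- `π n` is the projection to the piece `V n` of a grading. -/
structure IsGradedProjection (V : ℕ → Submodule k E) (π : ℕ → E →ₗ[k] E) : Prop where
  iSup_eq_top : ⨆ n, V n = ⊤
  self : ∀ n, ∀ v ∈ V n, π n v = v
  of_ne : ∀ m n, m ≠ n → ∀ v ∈ V m, π n v = 0

theorem IsGradedProjection.aeval {π : ℕ → E →ₗ[k] E} (hπ : IsGradedProjection V π)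
    (hT : ∀ n, ∀ v ∈ V n, T v ∈ V (n + 1)) {d : ℕ} {g : E} (hg : g ∈ V d) (p : k[X]) (n : ℕ) :
    π n (aeval T p g) = if d ≤ n then p.coeff (n - d) • (T ^ (n - d)) g else 0 := by
  induction p using Polynomial.induction_on' with
  | add p q hp hq =>
    rw [map_add, LinearMap.add_apply, map_add, hp, hq]
    split_ifs
    · rw [coeff_add, add_smul]
    · rw [add_zero]
  | monomial m a =>
    rw [aeval_monomial, Module.End.mul_apply, Module.algebraMap_end_apply, map_smul]
    have hm := pow_apply_mem hT m hg
    by_cases hn : d + m = n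
    · subst hn
      rw [hπ.self _ _ hm]
      simp
    · rw [hπ.of_ne _ _ hn _ hm, smul_zero]
      split_ifs with h
      · rw [coeff_monomial, if_neg (by omega), zero_smul]
      · rfl

theorem IsGradedProjection.sum_aeval {π : ℕ → E →ₗ[k] E} (hπ : IsGradedProjection V π)
    (hT : ∀ n, ∀ v ∈ V n, T v ∈ V (n + 1)) {ι : Type*} [Fintype ι] {deg : ι → ℕ} {g : ι → E}
    (hg : ∀ s, g s ∈ V (deg s)) (p : ι → k[X]) (n : ℕ) :
    π n (∑ s, Polynomial.aeval T (p s) (g s)) =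
      ∑ s with deg s ≤ n, (p s).coeff (n - deg s) • (T ^ (n - deg s)) (g s) := by
  rw [map_sum, Finset.sum_filter]
  exact Finset.sum_congr rfl fun s _ => hπ.aeval hT (hg s) (p s) n

/-- The annihilator of a generator of degree `d` that lives in the degrees `n` with `d ≤ n < e`,
or, if `r < e`, in all degrees from `d` on. -/
def annihilatorPoly (k : Type*) [Field k] (r d e : ℕ) : k[X] := if e ≤ r then X ^ (e - d) else 0

theorem pow_newKer_independent (hT : ∀ n, ∀ v ∈ V n, T v ∈ V (n + 1))
    {ι : Type*} [Fintype ι] {deg e : ι → ℕ} {g : ι → E}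
    (hg : ∀ s, g s ∈ newKer T V r (deg s) (e s))
    (hind : ∀ i j, LinearIndepOn k g {s | deg s = i ∧ e s = j})
    {n : ℕ} {c : ι → k} (hc : ∑ s with deg s ≤ n, c s • (T ^ (n - deg s)) (g s) = 0)
    {s : ι} (hs : deg s ≤ n) (hes : n < e s) : c s = 0 := by
  classical
  set w : ℕ → ℕ → E := fun i j => ∑ s with deg s = i ∧ e s = j, c s • g s with hw
  have hwmem : ∀ i j, w i j ∈ newKer T V r i j := by
    intro i j
    refine Submodule.sum_mem _ fun s hs => Submodule.smul_mem _ _ ?_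
    obtain ⟨rfl, rfl⟩ := (Finset.mem_filter.1 hs).2
    exact hg s
  have hsum : ∑ i ∈ Finset.range (n + 1), ∑ j ∈ Finset.univ.image e, (T ^ (n - i)) (w i j) = 0 := by
    rw [← hc, ← Finset.sum_fiberwise_of_maps_to (t := Finset.range (n + 1)) (g := deg)
      (fun s hs => Finset.mem_range.2 (Nat.lt_succ_of_le (Finset.mem_filter.1 hs).2))]
    refine Finset.sum_congr rfl fun i hi => ?_
    rw [← Finset.sum_fiberwise_of_maps_to (t := Finset.univ.image e) (g := e)
      (fun s _ => Finset.mem_image_of_mem e (Finset.mem_univ s))]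
    refine Finset.sum_congr rfl fun j _ => ?_
    rw [hw, map_sum]
    refine Finset.sum_congr ?_ fun s hs => ?_
    · ext s
      have := Finset.mem_range.1 hi
      simp only [Finset.mem_filter, Finset.mem_univ, true_and]
      omega
    · simp only [Finset.mem_filter] at hs
      rw [map_smul, hs.1.2]
  -- The choice `e₀ = n` recovers the terms with `n < e`, those not yet killed in degree `n`.
  have h0 := newKer_independent hT hwmem n n le_rfl (D := Finset.univ.image e)
    (by rw [hsum]; exact zero_mem _) (deg s) hs (e s)
    (Finset.mem_image_of_mem e (Finset.mem_univ s)) hes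
  have h1 := linearIndepOn_iff'.1 (hind (deg s) (e s))
    (Finset.univ.filter fun s' => deg s' = deg s ∧ e s' = e s) c (by intro s'; simp) h0
  exact h1 s (by simp)

/-- A relation is split into homogeneous components. Up to degree `r` these are handled by
`pow_newKer_independent`; in higher degrees injectivity of `T` brings relations back to degree `r`,
and surjectivity gives the spanning. -/
theorem isCyclicDecomposition_of_newKer {π : ℕ → E →ₗ[k] E} (hπ : IsGradedProjection V π)
    (hT : ∀ n, ∀ v ∈ V n, T v ∈ V (n + 1)) (hsurj : ∀ n ≥ r, V (n + 1) ≤ (V n).map T)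
    (hinj : ∀ n ≥ r, ∀ v ∈ V n, T v = 0 → v = 0)
    {ι : Type*} [Fintype ι] {deg e : ι → ℕ} {g : ι → E}
    (hg : ∀ s, g s ∈ newKer T V r (deg s) (e s)) (hdeg : ∀ s, deg s ≤ r)
    (hind : ∀ i j, LinearIndepOn k g {s | deg s = i ∧ e s = j})
    (hspan : ∀ i ≤ r, ∀ j ≤ r + 1,
      newKer T V r i j ≤ Submodule.span k (g '' {s | deg s = i ∧ e s = j})) :
    IsCyclicDecomposition T V deg (fun s => annihilatorPoly k r (deg s) (e s)) g := by
  classical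
  have hgV : ∀ s, g s ∈ V (deg s) := fun s => newKer_le _ _ (hg s)
  refine ⟨hgV, fun s => ?_, fun p hp s => ?_, fun v => ?_⟩
  · unfold annihilatorPoly
    split_ifs with h
    · have := newKer_le_liveKer _ _ (hg s)
      rw [liveKer, if_pos h] at this
      simpa using this.2
    · simp
  · have hcoeff : ∀ n, ∑ s with deg s ≤ n, (p s).coeff (n - deg s) • (T ^ (n - deg s)) (g s) = 0 := by
      intro n
      rw [← hπ.sum_aeval hT hgV, hp, map_zero]
    have hsmall : ∀ d, deg s + d ≤ r → deg s + d < e s → (p s).coeff d = 0 := by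
      intro d hd hde
      have := pow_newKer_independent hT hg hind
        (c := fun s' => (p s').coeff (deg s + d - deg s')) (hcoeff _) (s := s) (by omega) hde
      simpa using this
    unfold annihilatorPoly
    split_ifs with h
    · rw [X_pow_dvd_iff]
      exact fun d hd => hsmall d (by omega) (by omega)
    · rw [zero_dvd_iff]
      ext d
      rw [coeff_zero]
      by_cases hd : deg s + d ≤ r
      · exact hsmall d hd (by omega)
      · have hinj' : ∀ m, ∀ v ∈ V r, (T ^ m) v = 0 → v = 0 := by
          intro m
          induction m with
          | zero => exact fun v _ hv => by simpa using hv
          | succ m ih =>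
            intro v hv h0
            rw [pow_succ', Module.End.mul_apply] at h0
            exact ih v hv (hinj (r + m) (by omega) _ (pow_apply_mem hT m hv) h0)
        have hn := hcoeff (deg s + d)
        -- The relation in degree `deg s + d > r` is a power of `T` applied to this one in degree
        -- `r`, with the same coefficients; all generators occur in both since their degrees are at
        -- most `r`.
        have hr : ∑ s' with deg s' ≤ r,
            (p s').coeff (deg s + d - deg s') • (T ^ (r - deg s')) (g s') = 0 := by
          apply hinj' (deg s + d - r)
          · exact Submodule.sum_mem _ fun s' hs' => Submodule.smul_mem _ _
              (pow_sub_apply_mem hT (hdeg s') (hgV s'))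
          · rw [← hn, map_sum]
            refine Finset.sum_congr ?_ fun s' _ => ?_
            · ext s'
              have := hdeg s'
              simp only [Finset.mem_filter, Finset.mem_univ, true_and]
              omega
            · have := hdeg s'
              rw [map_smul, ← Module.End.mul_apply, ← pow_add]
              congr 3
              omega
        have := pow_newKer_independent hT hg hind
          (c := fun s' => (p s').coeff (deg s + d - deg s')) hr (s := s) (hdeg s) (by omega)
        simpa using this
  · let S : Submodule k E :=
      { carrier := {v | ∃ p : ι → k[X], ∑ s, aeval T (p s) (g s) = v}
        add_mem' := by
          rintro _ _ ⟨p, rfl⟩ ⟨p', rfl⟩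
          exact ⟨p + p', by simp [Finset.sum_add_distrib]⟩
        zero_mem' := ⟨0, by simp⟩
        smul_mem' := by
          rintro c _ ⟨p, rfl⟩
          exact ⟨c • p, by simp [Finset.smul_sum]⟩ }
    have hST : ∀ v ∈ S, T v ∈ S := by
      rintro _ ⟨p, rfl⟩
      exact ⟨fun s => X * p s, by simp [map_sum]⟩
    have hWS : ∀ i ≤ r, ∀ j ≤ r + 1, newKer T V r i j ≤ S := by
      intro i hi j hj
      refine (hspan i hi j hj).trans (Submodule.span_le.2 ?_)
      rintro _ ⟨s, _, rfl⟩
      refine ⟨Pi.single s 1, ?_⟩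
      rw [Finset.sum_eq_single s]
      · simp
      · intro s' _ hs'
        simp [hs']
      · simp
    have hV : ∀ n, V n ≤ S := by
      intro n
      rcases le_total n r with hn | hn
      · exact liveKer_le_of_newKer_le hST hWS n hn
      · induction n, hn using Nat.le_induction with
        | base => exact liveKer_le_of_newKer_le hST hWS r le_rfl
        | succ n hn ih =>
          intro v hv
          obtain ⟨u, hu, rfl⟩ := hsurj n hn hv
          exact hST _ (ih hu)
    have : (⊤ : Submodule k E) ≤ S := hπ.iSup_eq_top ▸ iSup_le hV
    exact this trivial

end GradedEndomorphism

/-! ### Matching the generators with the index sets of the theorem, and counting them. -/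

section Indices

open Polynomial

instance (r : ℕ) :
    Finite {p : ℕ × ℕ // (1 ≤ p.1 ∧ p.1 ≤ r - 1) ∧ (1 ≤ p.2 ∧ p.2 ≤ r - p.1)} :=
  Set.Finite.to_subtype (s := {p : ℕ × ℕ | (1 ≤ p.1 ∧ p.1 ≤ r - 1) ∧ (1 ≤ p.2 ∧ p.2 ≤ r - p.1)})
    ((Set.finite_Iic (r, r)).subset fun p hp => by
      have := hp.1.2
      have := hp.2.2
      exact ⟨by simp; omega, by simp; omega⟩)

instance (r : ℕ) :
    Fintype {p : ℕ × ℕ // (1 ≤ p.1 ∧ p.1 ≤ r - 1) ∧ (1 ≤ p.2 ∧ p.2 ≤ r - p.1)} :=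
  Fintype.ofFinite _

/-- The index set of all summands of `StandardModule`. -/
abbrev SummandIndex (r : ℕ) (α : ℕ → ℕ) (α' : ℕ → ℕ → ℕ) : Type :=
  FreeIndex r α ⊕ TorsionIndex r α'

/-- The degree of the generator of a summand. -/
def SummandIndex.deg {r : ℕ} {α : ℕ → ℕ} {α' : ℕ → ℕ → ℕ} : SummandIndex r α α' → ℕ :=
  Sum.elim (fun s => s.1) (fun t => t.1.1.1)

/-- The annihilator of the generator of a summand. -/
def SummandIndex.ann (k : Type*) [Field k] {r : ℕ} {α : ℕ → ℕ} {α' : ℕ → ℕ → ℕ} :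
    SummandIndex r α α' → k[X] :=
  Sum.elim (fun _ => 0) (fun t => X ^ t.1.1.2)

theorem sum_torsionIndex {r i : ℕ} (hi : 1 ≤ i) (F : ℕ → ℕ) :
    (∑ p : {p : ℕ × ℕ // (1 ≤ p.1 ∧ p.1 ≤ r - 1) ∧ (1 ≤ p.2 ∧ p.2 ≤ r - p.1)},
      if p.1.1 = i then F p.1.2 else 0) = if i ≤ r - 1 then ∑ j ∈ Finset.Icc 1 (r - i), F j else 0 := by
  rw [← Finset.sum_subtype ((Finset.Icc 1 (r - 1) ×ˢ Finset.Icc 1 r).filter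
      fun p => p.2 ≤ r - p.1) (by simp; omega) (fun p : ℕ × ℕ => if p.1 = i then F p.2 else 0),
    Finset.sum_filter, Finset.sum_product]
  split_ifs with h
  · rw [Finset.sum_eq_single i]
    · simp only [if_true]
      rw [← Finset.sum_filter]
      refine Finset.sum_congr ?_ fun _ _ => rfl
      ext j
      simp only [Finset.mem_filter, Finset.mem_Icc]
      omega
    · intro b _ hb
      simp [hb]
    · simp [hi, h]
  · refine Finset.sum_eq_zero fun a ha => ?_
    have := (Finset.mem_Icc.1 ha).2
    simp [show a ≠ i by omega]

theorem card_deg_eq {r : ℕ} {α : ℕ → ℕ} {α' : ℕ → ℕ → ℕ} {i : ℕ} (hi : 1 ≤ i) (hr : i ≤ r)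
    (h0 : i + 1 ≤ r → α' i (r - i) = 0) :
    Fintype.card {s : SummandIndex r α α' // s.deg = i} =
      α i + ∑ j ∈ Finset.Icc 1 (r - i - 1), α' i j := by
  classical
  rw [Fintype.card_subtype, Finset.card_filter, Fintype.sum_sum_type]
  congr 1
  · simp only [SummandIndex.deg, Sum.elim_inl, Fintype.sum_sigma]
    rw [Finset.sum_eq_single ⟨i, by omega⟩]
    · simp
    · rintro ⟨b, hb⟩ _ hne
      have : b ≠ i := fun h => hne (Fin.ext h)
      simp [this]
    · simp
  · simp only [SummandIndex.deg, Sum.elim_inr, Fintype.sum_sigma]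
    have := sum_torsionIndex (r := r) hi (fun j => α' i j)
    calc _ = ∑ p : {p : ℕ × ℕ // (1 ≤ p.1 ∧ p.1 ≤ r - 1) ∧ (1 ≤ p.2 ∧ p.2 ≤ r - p.1)},
          (if p.1.1 = i then α' i p.1.2 else 0) := by
          refine Finset.sum_congr rfl fun p _ => ?_
          split_ifs with h
          · simp [h]
          · simp [h]
      _ = _ := by
          rw [this]
          split_ifs with h
          · rw [show r - i = r - i - 1 + 1 by omega, Finset.sum_Icc_succ_top (by omega)]
            rw [show r - i - 1 + 1 = r - i by omega, h0 (by omega), add_zero]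
          -- Here `i = r`: there are no torsion summands of this degree, and truncated subtraction
          -- makes the interval empty.
          · rw [show r - i - 1 = 0 by omega]
            simp

variable {k E : Type*} [Field k] [AddCommGroup E] [Module k E]
  {T : Module.End k E} {V : ℕ → Submodule k E} {r : ℕ}

theorem newKer_eq_bot_of_liveKer {i e : ℕ} (h : liveKer T V r i e = ⊥) :
    newKer T V r i e = ⊥ :=
  le_bot_iff.1 ((newKer_le_liveKer i e).trans h.le)

theorem exists_isCyclicDecomposition {π : ℕ → E →ₗ[k] E} (hπ : IsGradedProjection V π)
    (hT : ∀ n, ∀ v ∈ V n, T v ∈ V (n + 1)) (hsurj : ∀ n ≥ r, V (n + 1) ≤ (V n).map T)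
    (hinj : ∀ n ≥ r, ∀ v ∈ V n, T v = 0 → v = 0)
    (h0 : ∀ j, ∀ v ∈ V 0, (T ^ j) v = 0 → v = 0) (hfin : ∀ n, Module.Finite k (V n)) :
    ∃ (α : ℕ → ℕ) (α' : ℕ → ℕ → ℕ) (g : SummandIndex r α α' → E),
      IsCyclicDecomposition T V SummandIndex.deg (SummandIndex.ann k) g := by
  have hfinW : ∀ i e, Module.Finite k (newKer T V r i e) := fun i e =>
    Submodule.finiteDimensional_of_le (newKer_le i e)
  let b : ∀ i e, Module.Basis (Fin (Module.finrank k (newKer T V r i e))) k (newKer T V r i e) :=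
    fun i e => Module.finBasis k _
  -- Free generators are those that never die, recorded by `e = r + 1`; a torsion generator of
  -- degree `i` and order `j` dies in degree `e = i + j`.
  let α : ℕ → ℕ := fun i => Module.finrank k (newKer T V r i (r + 1))
  let α' : ℕ → ℕ → ℕ := fun i j => Module.finrank k (newKer T V r i (i + j))
  let e : SummandIndex r α α' → ℕ := Sum.elim (fun _ => r + 1) (fun t => t.1.1.1 + t.1.1.2)
  let g : SummandIndex r α α' → E :=
    Sum.elim (fun s => b s.1 (r + 1) s.2) (fun t => b t.1.1.1 (t.1.1.1 + t.1.1.2) t.2)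
  -- The generators with data `(i, j)` are either listed by the chosen basis or absent. In the
  -- absent case within range, `newKer` is zero: either `j ≤ i`, or `i = 0` and `h0` excludes
  -- torsion.
  have hfib : ∀ i j, (∃ f : Fin (Module.finrank k (newKer T V r i j)) → SummandIndex r α α',
      Function.Injective f ∧ {s | s.deg = i ∧ e s = j} = Set.range f ∧
        ∀ a, g (f a) = b i j a) ∨
      ({s : SummandIndex r α α' | s.deg = i ∧ e s = j} = ∅ ∧
        (i ≤ r → j ≤ r + 1 → newKer T V r i j = ⊥)) := by
    intro i j
    by_cases h1 : i ≤ r ∧ j = r + 1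
    · left
      obtain ⟨hi, rfl⟩ := h1
      refine ⟨fun a => Sum.inl ⟨⟨i, by omega⟩, a⟩, ?_, ?_, fun a => rfl⟩
      · intro a a' h
        simpa using h
      · ext s
        constructor
        · rintro ⟨hs, hs'⟩
          rcases s with ⟨⟨i', hi'⟩, a⟩ | ⟨⟨⟨i', j'⟩, h⟩, a⟩
          · obtain rfl : i' = i := hs
            exact ⟨a, rfl⟩
          · exfalso
            have : i' + j' = r + 1 := hs'
            simp only at h
            omega
        · rintro ⟨a, rfl⟩
          exact ⟨rfl, rfl⟩
    by_cases h2 : (1 ≤ i ∧ i ≤ r - 1) ∧ i + 1 ≤ j ∧ j ≤ r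
    · left
      obtain ⟨d, rfl⟩ := Nat.exists_eq_add_of_le (show i ≤ j by omega)
      refine ⟨fun a => Sum.inr ⟨⟨(i, d), h2.1, by simp only; omega, by simp only; omega⟩, a⟩, ?_, ?_,
        fun a => rfl⟩
      · intro a a' h
        simpa using h
      · ext s
        constructor
        · rintro ⟨hs, hs'⟩
          rcases s with ⟨⟨i', hi'⟩, a⟩ | ⟨⟨⟨i', j'⟩, h⟩, a⟩
          · exfalso
            have : r + 1 = i + d := hs'
            omega
          · obtain rfl : i' = i := hs
            have : i' + j' = i' + d := hs'
            obtain rfl : j' = d := by omega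
            exact ⟨a, rfl⟩
        · rintro ⟨a, rfl⟩
          exact ⟨rfl, rfl⟩
    · right
      constructor
      · rw [Set.eq_empty_iff_forall_notMem]
        rintro s ⟨hs, hs'⟩
        rcases s with ⟨⟨i', hi'⟩, a⟩ | ⟨⟨⟨i', j'⟩, h⟩, a⟩
        · have : i' = i := hs
          have : r + 1 = j := hs'
          omega
        · have : i' = i := hs
          have : i' + j' = j := hs'
          simp only at h
          omega
      · intro hi hj
        apply newKer_eq_bot_of_liveKer
        by_cases hji : j ≤ i
        · exact liveKer_eq_bot (by omega) hji
        · obtain rfl : i = 0 := by omega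
          rw [liveKer, if_pos (by omega), eq_bot_iff]
          exact fun v hv => h0 _ v hv.1 hv.2
  refine ⟨α, α', g, ?_⟩
  have hg : ∀ s, g s ∈ newKer T V r s.deg (e s) := by
    rintro (s | t)
    · exact (b s.1 (r + 1) s.2).2
    · exact (b t.1.1.1 (t.1.1.1 + t.1.1.2) t.2).2
  have hdeg : ∀ s : SummandIndex r α α', s.deg ≤ r := by
    rintro (s | t)
    · exact Nat.lt_succ_iff.1 s.1.2
    · exact t.1.2.1.2.trans (Nat.sub_le _ _)
  have hmain := isCyclicDecomposition_of_newKer hπ hT hsurj hinj hg hdeg ?_ ?_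
  · convert hmain using 1
    funext s
    rcases s with s | t
    · change (0 : k[X]) = if r + 1 ≤ r then _ else 0
      rw [if_neg (by omega)]
    · change (X : k[X]) ^ t.1.1.2 = if t.1.1.1 + t.1.1.2 ≤ r then
        X ^ (t.1.1.1 + t.1.1.2 - t.1.1.1) else 0
      have := t.1.2.1.2
      have := t.1.2.2.2
      rw [if_pos (by omega), Nat.add_sub_cancel_left]
  · intro i j
    rcases hfib i j with ⟨f, hf, hrange, hgf⟩ | ⟨hempty, _⟩
    · rw [hrange, linearIndepOn_range_iff hf]
      have : g ∘ f = (newKer T V r i j).subtype ∘ b i j := funext hgf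
      rw [this]
      exact (b i j).linearIndependent.map' _ (Submodule.ker_subtype _)
    · rw [hempty]
      exact linearIndepOn_empty k g
  · intro i hi j hj
    rcases hfib i j with ⟨f, hf, hrange, hgf⟩ | ⟨_, hbot⟩
    · have : g '' Set.range f = (newKer T V r i j).subtype '' Set.range (b i j) := by
        rw [← Set.range_comp, ← Set.range_comp]
        congr 1
        exact funext hgf
      rw [hrange, this, Submodule.span_image, (b i j).span_eq, Submodule.map_top,
        Submodule.range_subtype]
    · rw [hbot hi hj]
      exact bot_le

variable {ι : Type*} [Fintype ι] {deg : ι → ℕ} {q : ι → k[X]} {g : ι → E}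

theorem IsCyclicDecomposition.exists_sum_X_mul (h : IsCyclicDecomposition T V deg q g) {n : ℕ} {t : E}
    (ht : t ∈ prevImage T V n) : ∃ p : ι → k[X], ∑ s, aeval T (X * p s) (g s) = t := by
  cases n with
  | zero =>
    refine ⟨0, ?_⟩
    rw [(Submodule.mem_bot k).1 ht]
    simp
  | succ n =>
    obtain ⟨u, _, rfl⟩ := ht
    obtain ⟨p, rfl⟩ := h.span u
    exact ⟨p, by simp [map_sum]⟩

/-- The generators of degree `n` give coordinates on the degree `n` piece modulo the image of `T`. -/
theorem IsCyclicDecomposition.exists_coordinates (h : IsCyclicDecomposition T V deg q g)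
    {π : ℕ → E →ₗ[k] E} (hπ : IsGradedProjection V π) (hT : ∀ n, ∀ v ∈ V n, T v ∈ V (n + 1))
    (hq : ∀ s, X ∣ q s) (n : ℕ) :
    ∃ η : V n →ₗ[k] ({s // deg s = n} → k), Function.Surjective η ∧
      LinearMap.ker η = (prevImage T V n).submoduleOf (V n) := by
  classical
  set L := (prevImage T V n).submoduleOf (V n)
  let G : {s // deg s = n} → V n := fun s => ⟨g s, by
    have := h.mem s
    rwa [s.2] at this⟩
  let u : {s // deg s = n} → V n ⧸ L := fun s => L.mkQ (G s)
  have hG : ∀ c : {s // deg s = n} → k, ((∑ s, c s • G s : V n) : E) = ∑ s, c s • g s := by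
    intro c
    simp [G]
  have hli : LinearIndependent k u := by
    rw [Fintype.linearIndependent_iff]
    intro c hc
    have hc' : L.mkQ (∑ s, c s • G s) = 0 := by
      rw [← hc, map_sum]
      simp only [map_smul, u]
    rw [← LinearMap.mem_ker, Submodule.ker_mkQ] at hc'
    have hc'' : ∑ s : {s // deg s = n}, c s • g s ∈ prevImage T V n := by
      have : ((∑ s, c s • G s : V n) : E) ∈ prevImage T V n := hc'
      rwa [hG] at this
    obtain ⟨p, hp⟩ := h.exists_sum_X_mul hc''
    let c' : ι → k := fun s => if hs : deg s = n then c ⟨s, hs⟩ else 0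
    have hsum : ∑ s, c' s • g s = ∑ s : {s // deg s = n}, c s • g s := by
      have h1 : ∑ s, c' s • g s = ∑ s with deg s = n, c' s • g s := by
        rw [Finset.sum_filter]
        refine Finset.sum_congr rfl fun s _ => ?_
        split_ifs with hs
        · rfl
        · simp [c', hs]
      rw [h1, Finset.sum_subtype (p := fun s => deg s = n) _ (by simp)]
      refine Finset.sum_congr rfl fun s _ => ?_
      simp [c', s.2]
    intro s
    -- This polynomial is divisible by `q s`, hence by `X`, so the constant `c' s` must vanish.
    have := h.dvd (fun s => C (c' s) - X * p s) (by
      simp only [map_sub, LinearMap.sub_apply, Finset.sum_sub_distrib, aeval_C,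
        Module.algebraMap_end_apply]
      rw [hp, hsum, sub_self]) s
    have h2 := (dvd_sub_left (Dvd.intro _ rfl)).1 ((hq s).trans this)
    rw [X_dvd_iff, coeff_C_zero] at h2
    simpa [c', s.2] using h2
  have hsp : ⊤ ≤ Submodule.span k (Set.range u) := by
    rintro v -
    obtain ⟨⟨v, hv⟩, rfl⟩ := L.mkQ_surjective v
    obtain ⟨p, hp⟩ := h.span v
    have hv' := hπ.sum_aeval hT h.mem p n
    rw [hp, hπ.self n v hv] at hv'
    -- In the degree `n` component of `v`, generators of degree below `n` occur only with a positive
    -- power of `T`.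
    have hmem : v - ∑ s : {s // deg s = n}, (p s).coeff 0 • g s ∈ prevImage T V n := by
      rw [← Finset.sum_subtype (p := fun s => deg s = n) (Finset.univ.filter fun s => deg s = n)
        (by simp) (fun s => (p s).coeff 0 • g s), hv',
        ← Finset.sum_filter_add_sum_filter_not (Finset.univ.filter fun s => deg s ≤ n)
          (fun s => deg s = n), Finset.filter_filter, Finset.filter_filter]
      have h1 : ∑ s with deg s ≤ n ∧ deg s = n, (p s).coeff (n - deg s) • (T ^ (n - deg s)) (g s) =
          ∑ s with deg s = n, (p s).coeff 0 • g s := by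
        refine Finset.sum_congr ?_ fun s hs => ?_
        · ext s
          simp only [Finset.mem_filter, Finset.mem_univ, true_and, and_iff_right_iff_imp]
          exact le_of_eq
        · rw [(Finset.mem_filter.1 hs).2]
          simp
      rw [h1, add_sub_cancel_left]
      refine Submodule.sum_mem _ fun s hs => Submodule.smul_mem _ _ ?_
      obtain ⟨-, hs1, hs2⟩ := Finset.mem_filter.1 hs
      obtain ⟨m, rfl⟩ : ∃ m, n = m + 1 := ⟨n - 1, by omega⟩
      rw [show m + 1 - deg s = m - deg s + 1 by omega, pow_succ', Module.End.mul_apply]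
      exact Submodule.mem_map_of_mem (pow_sub_apply_mem hT (by omega) (h.mem s))
    have : L.mkQ ⟨v, hv⟩ = ∑ s : {s // deg s = n}, (p s).coeff 0 • u s := by
      have h1 : L.mkQ (⟨v, hv⟩ - ∑ s : {s // deg s = n}, (p s).coeff 0 • G s) = 0 := by
        rw [← LinearMap.mem_ker, Submodule.ker_mkQ]
        change ((⟨v, hv⟩ - ∑ s : {s // deg s = n}, (p s).coeff 0 • G s : V n) : E) ∈ prevImage T V n
        rw [Submodule.coe_sub, hG]
        exact hmem
      rw [map_sub, map_sum, sub_eq_zero] at h1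
      simpa only [map_smul, u] using h1
    rw [this]
    exact Submodule.sum_mem _ fun s _ => Submodule.smul_mem _ _ (Submodule.subset_span ⟨s, rfl⟩)
  let B := Module.Basis.mk hli hsp
  refine ⟨B.equivFun.toLinearMap ∘ₗ L.mkQ, ?_, ?_⟩
  · exact B.equivFun.surjective.comp L.mkQ_surjective
  · rw [LinearEquiv.ker_comp, Submodule.ker_mkQ]

/-- If `deg s + j = r`, then `T ^ (j - 1)` sends the generator to degree `r - 1`, where `T` is
injective. As `T ^ j` kills the generator, so does `T ^ (j - 1)`, against the annihilator `X ^ j`.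
-/
theorem IsCyclicDecomposition.ne_of_injective (h : IsCyclicDecomposition T V deg q g)
    (hT : ∀ n, ∀ v ∈ V n, T v ∈ V (n + 1))
    (hinj : ∀ n, r ≤ n + 1 → ∀ v ∈ V n, T v = 0 → v = 0) {s : ι} {j : ℕ} (hj : 1 ≤ j)
    (hq : q s = X ^ j) : deg s + j ≠ r := by
  classical
  intro hr
  obtain ⟨m, rfl⟩ := Nat.exists_eq_add_of_le' hj
  have h1 := h.annihilates s
  rw [hq, map_pow, aeval_X, pow_succ', Module.End.mul_apply] at h1
  have h2 := hinj _ (by omega) _ (pow_apply_mem hT m (h.mem s)) h1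
  have h3 := h.dvd (Pi.single s (X ^ m)) (by
    rw [Finset.sum_eq_single s]
    · simpa using h2
    · intro s' _ hs'
      simp [hs']
    · simp) s
  rw [hq, Pi.single_eq_same, pow_dvd_pow_iff X_ne_zero not_isUnit_X] at h3
  omega

end Indices

/-! ### The fiber cone as a graded vector space over the residue field. -/

namespace FiberCone

variable {A : Type*} [CommRing A] [IsLocalRing A] (I : Ideal A)

/-- The class of `a ∈ I ^ n` in degree `n` of the fiber cone. -/
def cls (n : ℕ) (a : A) (ha : a ∈ I ^ n) : FiberCone I := of I n (FiberPiece.mk I n ⟨a, ha⟩)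

variable {I}

theorem cls_congr {n m : ℕ} {a b : A} {ha : a ∈ I ^ n} (hb : b ∈ I ^ m) (h : n = m) (h' : a = b) :
    cls I n a ha = cls I m b hb := by
  subst h h'
  rfl

omit [IsLocalRing A] in
theorem mul_mem_pow {n m : ℕ} {a b : A} (ha : a ∈ I ^ n) (hb : b ∈ I ^ m) : a * b ∈ I ^ (n + m) := by
  rw [pow_add]
  exact Ideal.mul_mem_mul ha hb

theorem cls_mul_cls {n m : ℕ} {a b : A} (ha : a ∈ I ^ n) (hb : b ∈ I ^ m) :
    cls I n a ha * cls I m b hb = cls I (n + m) (a * b) (mul_mem_pow ha hb) :=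
  of_mul_of I n m _ _

theorem cls_add {n : ℕ} {a b : A} (ha : a ∈ I ^ n) (hb : b ∈ I ^ n) :
    cls I n (a + b) (add_mem ha hb) = cls I n a ha + cls I n b hb :=
  map_add (of I n) (FiberPiece.mk I n ⟨a, ha⟩) (FiberPiece.mk I n ⟨b, hb⟩)

theorem cls_eq_zero_iff {n : ℕ} {a : A} (ha : a ∈ I ^ n) :
    cls I n a ha = 0 ↔ a ∈ maximalIdeal A * I ^ n := by
  have h1 : cls I n a ha = 0 ↔ FiberPiece.mk I n ⟨a, ha⟩ = 0 :=
    map_eq_zero_iff (of I n) (DirectSum.of_injective n)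
  rw [h1]
  exact Submodule.Quotient.mk_eq_zero _

theorem mem_degree_iff {n : ℕ} {g : FiberCone I} :
    g ∈ degree I n ↔ ∃ a, ∃ ha : a ∈ I ^ n, cls I n a ha = g := by
  constructor
  · rintro ⟨y, rfl⟩
    induction y using Submodule.Quotient.induction_on with
    | H a => exact ⟨a.1, a.2, rfl⟩
  · rintro ⟨a, ha, rfl⟩
    exact ⟨_, rfl⟩

theorem cls_mem_degree {n : ℕ} {a : A} (ha : a ∈ I ^ n) : cls I n a ha ∈ degree I n :=
  mem_degree_iff.2 ⟨a, ha, rfl⟩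

@[elab_as_elim]
theorem induction {P : FiberCone I → Prop} (g : FiberCone I) (zero : P 0)
    (cls : ∀ n a ha, P (cls I n a ha)) (add : ∀ g h, P g → P h → P (g + h)) : P g := by
  refine DirectSum.induction_on g zero (fun n y => ?_) add
  induction y using Submodule.Quotient.induction_on with
  | H a => exact cls n a.1 a.2

omit [IsLocalRing A] in
theorem mem_pow_zero (a : A) : a ∈ I ^ 0 := by simp

theorem cls_zero_mul_cls (c : A) {n : ℕ} {a : A} (ha : a ∈ I ^ n) :
    cls I 0 c (mem_pow_zero c) * cls I n a ha = cls I n (c * a) (Ideal.mul_mem_left _ c ha) := by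
  rw [cls_mul_cls]
  exact cls_congr _ (zero_add n) rfl

variable (I) in
/-- The ring homomorphism from `A` to the degree zero part of the fiber cone. -/
def degreeZeroHom : A →+* FiberCone I where
  toFun a := cls I 0 a (mem_pow_zero a)
  map_one' := rfl
  map_zero' := (cls_eq_zero_iff _).2 (zero_mem _)
  map_add' _ _ := cls_add _ _
  map_mul' a b := (cls_zero_mul_cls a (mem_pow_zero b)).symm

/-- Kept beside the structure over the residue field, because lengths are taken over `A` and
dimensions over the residue field. -/
instance : Algebra A (FiberCone I) := (degreeZeroHom I).toAlgebra

instance : Algebra (ResidueField A) (FiberCone I) :=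
  RingHom.toAlgebra (Ideal.Quotient.lift (maximalIdeal A) (degreeZeroHom I) (fun a ha =>
    (cls_eq_zero_iff _).2 (by rwa [pow_zero, Ideal.one_eq_top, Ideal.mul_top])))

instance : IsScalarTower A (ResidueField A) (FiberCone I) :=
  IsScalarTower.of_algebraMap_eq fun _ => rfl

theorem smul_cls (c : A) {n : ℕ} {a : A} (ha : a ∈ I ^ n) :
    c • cls I n a ha = cls I n (c * a) (Ideal.mul_mem_left _ c ha) := by
  rw [Algebra.smul_def]
  exact cls_zero_mul_cls c ha

theorem residue_smul_cls (c : A) {n : ℕ} {a : A} (ha : a ∈ I ^ n) :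
    residue A c • cls I n a ha = cls I n (c * a) (Ideal.mul_mem_left _ c ha) := by
  rw [← smul_cls, ← IsLocalRing.ResidueField.algebraMap_eq, algebraMap_smul]

variable (I) in
/-- The degree `n` part of the fiber cone as a vector space over the residue field. -/
def piece (n : ℕ) : Submodule (ResidueField A) (FiberCone I) where
  toAddSubmonoid := (degree I n).toAddSubmonoid
  smul_mem' c g hg := by
    obtain ⟨c, rfl⟩ := residue_surjective c
    obtain ⟨a, ha, rfl⟩ := mem_degree_iff.1 hg
    rw [residue_smul_cls]
    exact cls_mem_degree _

theorem mem_piece_iff {n : ℕ} {g : FiberCone I} :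
    g ∈ piece I n ↔ ∃ a, ∃ ha : a ∈ I ^ n, cls I n a ha = g := mem_degree_iff

theorem cls_mem_piece {n : ℕ} {a : A} (ha : a ∈ I ^ n) : cls I n a ha ∈ piece I n :=
  cls_mem_degree ha

variable (I) in
/-- The projection to the degree `n` part as an additive map. -/
def projAddHom (n : ℕ) : FiberCone I →+ FiberCone I :=
  (of I n).comp (DFinsupp.evalAddMonoidHom (β := FiberPiece I) n)

theorem projAddHom_cls (n : ℕ) {m : ℕ} {a : A} (ha : a ∈ I ^ m) :
    projAddHom I n (cls I m a ha) = if m = n then cls I m a ha else 0 := by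
  split_ifs with h
  · subst h
    exact congrArg (of I m) (DirectSum.of_eq_same (β := FiberPiece I) m _)
  · exact (congrArg (of I n) (DirectSum.of_eq_of_ne (β := FiberPiece I) m n _ (Ne.symm h))).trans
      (map_zero _)

variable (I) in
/-- The projection to the degree `n` part. -/
def proj (n : ℕ) : FiberCone I →ₗ[ResidueField A] FiberCone I where
  __ := projAddHom I n
  map_smul' c g := by
    obtain ⟨c, rfl⟩ := residue_surjective c
    change projAddHom I n (residue A c • g) = residue A c • projAddHom I n g
    induction g using FiberCone.induction with
    | zero => simp
    | add g h hg hh => rw [smul_add, map_add, map_add, hg, hh, smul_add]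
    | cls m a ha =>
      rw [residue_smul_cls, projAddHom_cls, projAddHom_cls]
      split_ifs
      · rw [residue_smul_cls]
      · rw [smul_zero]

theorem isGradedProjection_proj : IsGradedProjection (piece I) (proj I) where
  iSup_eq_top := by
    rw [eq_top_iff]
    rintro g -
    induction g using FiberCone.induction with
    | zero => exact zero_mem _
    | add g h hg hh => exact add_mem hg hh
    | cls m a ha => exact Submodule.mem_iSup_of_mem m (cls_mem_piece ha)
  self n v hv := by
    obtain ⟨a, ha, rfl⟩ := mem_piece_iff.1 hv
    exact (projAddHom_cls n ha).trans (if_pos rfl)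
  of_ne m n hmn v hv := by
    obtain ⟨a, ha, rfl⟩ := mem_piece_iff.1 hv
    exact (projAddHom_cls n ha).trans (if_neg hmn)

variable (I) in
/-- The map from `I ^ n` to the degree `n` part of the fiber cone. -/
def clsMap (n : ℕ) : ↥(I ^ n) →ₗ[A] piece I n where
  toFun a := ⟨cls I n a.1 a.2, cls_mem_piece a.2⟩
  map_add' a b := Subtype.ext (cls_add a.2 b.2)
  map_smul' c a := Subtype.ext (smul_cls c a.2).symm

theorem clsMap_surjective (n : ℕ) : Function.Surjective (clsMap I n) := by
  rintro ⟨g, hg⟩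
  obtain ⟨a, ha, rfl⟩ := mem_piece_iff.1 hg
  exact ⟨⟨a, ha⟩, rfl⟩

instance [IsNoetherianRing A] (n : ℕ) : Module.Finite (ResidueField A) (piece I n) :=
  have : Module.Finite A (piece I n) := Module.Finite.of_surjective _ (clsMap_surjective n)
  Module.Finite.of_restrictScalars_finite A _ _

theorem map_cls {J I : Ideal A} (h : J ≤ I) {n : ℕ} {a : A} (ha : a ∈ J ^ n) :
    map h (cls J n a ha) = cls I n a (Ideal.pow_right_mono h n ha) :=
  DirectSum.toAddMonoid_of _ _ _

theorem map_smul_residue {J I : Ideal A} (h : J ≤ I) (c : ResidueField A) (f : FiberCone J) :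
    map h (c • f) = c • map h f := by
  obtain ⟨c, rfl⟩ := residue_surjective c
  induction f using FiberCone.induction with
  | zero => simp
  | add f g hf hg => rw [smul_add, map_add, map_add, hf, hg, smul_add]
  | cls m a ha => rw [residue_smul_cls, map_cls, map_cls, residue_smul_cls]

/-- `FiberCone.map` as a homomorphism of algebras over the residue field. -/
def mapAlgHom {J I : Ideal A} (h : J ≤ I) : FiberCone J →ₐ[ResidueField A] FiberCone I :=
  AlgHom.mk' (map h) (map_smul_residue h)

end FiberCone

/-! ### `F(x)` as a polynomial ring, and graded isomorphisms as cyclic decompositions. -/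

section NoetherNormalization

open Polynomial FiberCone

variable {A : Type*} [CommRing A] [IsLocalRing A] {x : A}

/-- Serves for the two surjections from one free module over `k[X]`, onto the tangent cone and onto
`StandardModule`. -/
theorem exists_addEquiv_of_ker_eq {M N P : Type*} [AddCommGroup M] [AddCommGroup N] [AddCommGroup P]
    (f : M →+ N) (g : M →+ P) (hf : Function.Surjective f) (hg : Function.Surjective g)
    (h : f.ker = g.ker) : ∃ φ : N ≃+ P, ∀ m, φ (f m) = g m := by
  refine ⟨(QuotientAddGroup.quotientKerEquivOfSurjective f hf).symm.trans
    ((QuotientAddGroup.quotientAddEquivOfEq h).trans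
      (QuotientAddGroup.quotientKerEquivOfSurjective g hg)), fun m => ?_⟩
  have : (QuotientAddGroup.quotientKerEquivOfSurjective f hf).symm (f m) =
      (QuotientAddGroup.mk m : M ⧸ f.ker) := by
    rw [AddEquiv.symm_apply_eq]
    rfl
  rw [AddEquiv.trans_apply, this]
  rfl

theorem xStar_pow (n : ℕ) :
    xStar x ^ n = cls (Ideal.span {x}) n (x ^ n)
      (Ideal.pow_mem_pow (Ideal.mem_span_singleton_self x) n) := by
  induction n with
  | zero => exact (cls_congr (mem_pow_zero 1) rfl (pow_zero x)).symm
  | succ n ih =>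
    rw [pow_succ, ih]
    exact (cls_mul_cls _ (by rw [pow_one]; exact Ideal.mem_span_singleton_self x)).trans
      (cls_congr _ rfl (pow_succ x n).symm)

theorem aeval_xStar_monomial (n : ℕ) (a : A) :
    aeval (xStar x) (monomial n (residue A a)) =
      cls (Ideal.span {x}) n (a * x ^ n) (Ideal.mul_mem_left _ _
        (Ideal.pow_mem_pow (Ideal.mem_span_singleton_self x) n)) := by
  rw [aeval_monomial, xStar_pow, ← Algebra.smul_def, residue_smul_cls]

theorem mem_degree_span_iff {n : ℕ} {f : NoetherNormalization x} :
    f ∈ degree (Ideal.span {x}) n ↔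
      ∃ c : ResidueField A, aeval (xStar x) (monomial n c) = f := by
  constructor
  · intro hf
    obtain ⟨a, ha, rfl⟩ := mem_degree_iff.1 hf
    have ha' := ha
    rw [Ideal.span_singleton_pow, Ideal.mem_span_singleton'] at ha'
    obtain ⟨b, rfl⟩ := ha'
    exact ⟨residue A b, aeval_xStar_monomial n b⟩
  · rintro ⟨c, rfl⟩
    obtain ⟨c, rfl⟩ := residue_surjective c
    rw [aeval_xStar_monomial]
    exact cls_mem_degree _

theorem aeval_xStar_surjective :
    Function.Surjective (aeval (R := ResidueField A) (xStar x)) := by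
  intro f
  induction f using FiberCone.induction with
  | zero => exact ⟨0, map_zero _⟩
  | add f g hf hg =>
    obtain ⟨p, rfl⟩ := hf
    obtain ⟨q, rfl⟩ := hg
    exact ⟨p + q, map_add _ _ _⟩
  | cls n a ha =>
    obtain ⟨c, hc⟩ := mem_degree_span_iff.1 (cls_mem_degree ha)
    exact ⟨_, hc⟩

theorem aeval_lmul {k R : Type*} [Field k] [CommRing R] [Algebra k R] (t : R) (p : k[X]) (g : R) :
    aeval (Algebra.lmul k R t) p g = aeval t p * g := by
  rw [aeval_algHom_apply]
  rfl

/-- The degree `n` component of `p(x*)` is the class of `a * x ^ n`, where `a` lifts the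
coefficient. It vanishes only if `a * x ^ n = b * x ^ n` with `b ∈ 𝔪`, and cancelling `x ^ n` gives
`a = b`. -/
theorem aeval_xStar_injective (hreg : x ∈ nonZeroDivisors A) :
    Function.Injective (aeval (R := ResidueField A) (xStar x)) := by
  rw [injective_iff_map_eq_zero]
  intro p hp
  ext n
  have hT : ∀ n, ∀ v ∈ piece (Ideal.span {x}) n,
      Algebra.lmul (ResidueField A) (NoetherNormalization x) (xStar x) v ∈
        piece (Ideal.span {x}) (n + 1) := by
    intro n v hv
    obtain ⟨a, ha, rfl⟩ := mem_piece_iff.1 hv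
    rw [Algebra.coe_lmul_eq_mul, LinearMap.mul_apply', mul_comm]
    exact (cls_mul_cls ha _).symm ▸ cls_mem_piece _
  have h1 : (1 : NoetherNormalization x) ∈ piece (Ideal.span {x}) 0 :=
    cls_mem_piece (mem_pow_zero 1)
  have h := isGradedProjection_proj.aeval hT h1 p n
  rw [aeval_lmul, hp, zero_mul, map_zero, if_pos (Nat.zero_le n), Nat.sub_zero, ← map_pow] at h
  obtain ⟨a, ha⟩ := residue_surjective (p.coeff n)
  have h2 : Algebra.lmul (ResidueField A) (NoetherNormalization x) (xStar x ^ n) 1 =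
      xStar x ^ n := mul_one _
  rw [h2, xStar_pow, ← ha, residue_smul_cls, eq_comm, cls_eq_zero_iff, Ideal.span_singleton_pow,
    Ideal.mem_mul_span_singleton] at h
  obtain ⟨b, hb, hba⟩ := h
  have : b = a := by
    rw [← sub_eq_zero]
    apply (nonZeroDivisors A).pow_mem hreg n |>.2
    rw [sub_mul, hba, sub_self]
  rw [coeff_zero, ← ha, residue_eq_zero_iff, ← this]
  exact hb

theorem aeval_xStar_mem_span_iff (hreg : x ∈ nonZeroDivisors A) (j : ℕ)
    (p : (ResidueField A)[X]) :
    aeval (xStar x) p ∈ Ideal.span {xStar x ^ j} ↔ X ^ j ∣ p := by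
  rw [Ideal.mem_span_singleton]
  constructor
  · rintro ⟨f, hf⟩
    obtain ⟨q, rfl⟩ := aeval_xStar_surjective f
    refine ⟨q, aeval_xStar_injective hreg ?_⟩
    rw [hf, map_mul, map_pow, aeval_X]
  · rintro ⟨q, rfl⟩
    exact ⟨aeval (xStar x) q, by rw [map_mul, map_pow, aeval_X]⟩

variable (x) (r : ℕ) (α : ℕ → ℕ) (α' : ℕ → ℕ → ℕ)

/-- The surjection onto `StandardModule` from a free module over the polynomial ring. -/
def toStandard : (SummandIndex r α α' → (ResidueField A)[X]) →+ StandardModule x r α α' where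
  toFun p := (fun s => aeval (xStar x) (p (Sum.inl s)),
    fun t => Ideal.Quotient.mk _ (aeval (xStar x) (p (Sum.inr t))))
  map_zero' := by
    ext <;> simp
  map_add' p q := by
    ext <;> simp

variable {x r α α'}

theorem toStandard_surjective : Function.Surjective (toStandard x r α α') := by
  rintro ⟨y, z⟩
  choose p hp using fun s => aeval_xStar_surjective (y s)
  choose q hq using fun t => (Ideal.Quotient.mk_surjective.comp aeval_xStar_surjective) (z t)
  exact ⟨Sum.elim p q, Prod.ext (funext hp) (funext hq)⟩

theorem toStandard_eq_zero_iff (hreg : x ∈ nonZeroDivisors A)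
    (p : SummandIndex r α α' → (ResidueField A)[X]) :
    toStandard x r α α' p = 0 ↔ ∀ s, SummandIndex.ann (ResidueField A) s ∣ p s := by
  rw [Prod.ext_iff, funext_iff, funext_iff, Sum.forall]
  refine and_congr (forall_congr' fun s => ?_) (forall_congr' fun t => ?_)
  · change aeval (xStar x) (p (Sum.inl s)) = 0 ↔ 0 ∣ p (Sum.inl s)
    rw [zero_dvd_iff, map_eq_zero_iff _ (aeval_xStar_injective hreg)]
  · change Ideal.Quotient.mk _ (aeval (xStar x) (p (Sum.inr t))) = 0 ↔
      X ^ t.1.1.2 ∣ p (Sum.inr t)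
    rw [Ideal.Quotient.eq_zero_iff_mem, aeval_xStar_mem_span_iff hreg]

theorem toStandard_smul (q : (ResidueField A)[X]) (p : SummandIndex r α α' → (ResidueField A)[X]) :
    toStandard x r α α' (q • p) = aeval (xStar x) q • toStandard x r α α' p := by
  refine Prod.ext (funext fun s => ?_) (funext fun t => ?_)
  · exact map_mul (aeval (xStar x)) q (p (Sum.inl s))
  · change Ideal.Quotient.mk _ (aeval (xStar x) (q * p (Sum.inr t))) = _
    rw [map_mul]
    rfl

/-- Each `p s` is a monomial of degree `n - deg s`, or zero if `n < deg s`. -/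
def IsMonomialVector (n : ℕ) (p : SummandIndex r α α' → (ResidueField A)[X]) : Prop :=
  ∀ s, ∃ c, p s = if s.deg ≤ n then monomial (n - s.deg) c else 0

theorem mem_freeDegree_iff {i n : ℕ} {f : NoetherNormalization x} :
    f ∈ freeDegree x i n ↔
      ∃ c : ResidueField A, aeval (xStar x) (if i ≤ n then monomial (n - i) c else 0) = f := by
  unfold freeDegree
  split_ifs with h
  · exact mem_degree_span_iff
  · simp [eq_comm]

theorem isHomogeneous_iff {n : ℕ} {y : StandardModule x r α α'} :
    StandardModule.IsHomogeneous x r α α' n y ↔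
      ∃ p, IsMonomialVector n p ∧ toStandard x r α α' p = y := by
  constructor
  · rintro ⟨h1, h2⟩
    choose c hc using fun s => mem_freeDegree_iff.1 (h1 s)
    choose f hf hfy using h2
    choose d hd using fun t => mem_freeDegree_iff.1 (hf t)
    refine ⟨fun s => if s.deg ≤ n then monomial (n - s.deg) (Sum.elim c d s) else 0,
      fun s => ⟨_, rfl⟩, Prod.ext (funext hc) (funext fun t => ?_)⟩
    rw [← hfy t, ← hd t]
    rfl
  · rintro ⟨p, hp, rfl⟩
    refine ⟨fun s => mem_freeDegree_iff.2 ?_, fun t => ⟨aeval (xStar x) (p (Sum.inr t)),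
      mem_freeDegree_iff.2 ?_, rfl⟩⟩
    · obtain ⟨c, hc⟩ := hp (Sum.inl s)
      exact ⟨c, congrArg (aeval (xStar x)) hc.symm⟩
    · obtain ⟨c, hc⟩ := hp (Sum.inr t)
      exact ⟨c, congrArg (aeval (xStar x)) hc.symm⟩

variable (hx : Ideal.span {x} ≤ maximalIdeal A)

/-- Multiplication by the initial form of `x` on the tangent cone. -/
def mulInitial : Module.End (ResidueField A) (TangentCone A) :=
  Algebra.lmul (ResidueField A) (TangentCone A) (map hx (xStar x))

theorem aeval_mulInitial (p : (ResidueField A)[X]) (g : TangentCone A) :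
    aeval (mulInitial hx) p g = map hx (aeval (xStar x) p) * g := by
  rw [mulInitial, aeval_lmul]
  congr 1
  exact aeval_algHom_apply (mapAlgHom hx) (xStar x) p

theorem mem_maximalIdeal_of_span_le (hx : Ideal.span {x} ≤ maximalIdeal A) :
    x ∈ maximalIdeal A ^ 1 := by
  rw [pow_one]
  exact hx (Ideal.mem_span_singleton_self x)

theorem mulInitial_cls {n : ℕ} {a : A} (ha : a ∈ maximalIdeal A ^ n) :
    mulInitial hx (cls _ n a ha) =
      cls _ (n + 1) (a * x) (mul_mem_pow ha (mem_maximalIdeal_of_span_le hx)) := by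
  rw [← cls_mul_cls ha (mem_maximalIdeal_of_span_le hx), mul_comm]
  exact congrArg (· * _) (map_cls hx _)

theorem mulInitial_pow_cls (j : ℕ) {n : ℕ} {a : A} (ha : a ∈ maximalIdeal A ^ n) :
    (mulInitial hx ^ j) (cls _ n a ha) =
      cls _ (n + j) (a * x ^ j) (mul_mem_pow ha
        (by simpa using Ideal.pow_mem_pow (mem_maximalIdeal_of_span_le hx) j)) := by
  induction j with
  | zero =>
    rw [pow_zero, Module.End.one_apply]
    exact cls_congr _ rfl (by simp)
  | succ j ih =>
    rw [pow_succ', Module.End.mul_apply, ih, mulInitial_cls]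
    exact cls_congr _ rfl (by ring)

theorem mulInitial_mem (n : ℕ) : ∀ v ∈ piece (maximalIdeal A) n,
    mulInitial hx v ∈ piece (maximalIdeal A) (n + 1) := by
  intro v hv
  obtain ⟨a, ha, rfl⟩ := mem_piece_iff.1 hv
  rw [mulInitial_cls]
  exact cls_mem_piece _

/-- An isomorphism of the tangent cone with `StandardModule` is the same thing as a decomposition
of the tangent cone into cyclic modules over the polynomial ring. -/
theorem exists_iso_iff_exists_isCyclicDecomposition (hreg : x ∈ nonZeroDivisors A) :
    (∃ φ : TangentCone A ≃+ StandardModule x r α α',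
      (∀ (f : NoetherNormalization x) (g : TangentCone A), φ (map hx f * g) = f • φ g) ∧
      ∀ (n : ℕ) (g : TangentCone A), g ∈ degree (maximalIdeal A) n ↔
        StandardModule.IsHomogeneous x r α α' n (φ g)) ↔
    ∃ g : SummandIndex r α α' → TangentCone A,
      IsCyclicDecomposition (mulInitial hx) (piece (maximalIdeal A)) SummandIndex.deg
        (SummandIndex.ann (ResidueField A)) g := by
  classical
  constructor
  · rintro ⟨φ, hφ, hdeg⟩
    have hsymm : ∀ (q : (ResidueField A)[X]) y, φ.symm (aeval (xStar x) q • y) = aeval (mulInitial hx) q (φ.symm y) := by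
      intro q y
      rw [aeval_mulInitial, AddEquiv.symm_apply_eq, hφ, AddEquiv.apply_symm_apply]
    have hsum : ∀ p : SummandIndex r α α' → (ResidueField A)[X],
        ∑ s, aeval (mulInitial hx) (p s) (φ.symm (toStandard x r α α' (Pi.single s 1))) =
          φ.symm (toStandard x r α α' p) := by
      intro p
      have hp : p = ∑ s, p s • Pi.single s 1 := by
        funext s
        simp [Finset.sum_apply, Pi.single_apply]
      conv_rhs => rw [hp, map_sum, map_sum]
      refine Finset.sum_congr rfl fun s _ => ?_
      rw [toStandard_smul, hsymm]
    refine ⟨fun s => φ.symm (toStandard x r α α' (Pi.single s 1)), fun s => ?_, fun s => ?_,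
      fun p hp => ?_, fun v => ?_⟩
    · refine (hdeg _ _).2 ?_
      rw [AddEquiv.apply_symm_apply, isHomogeneous_iff]
      refine ⟨_, fun s' => ?_, rfl⟩
      by_cases h : s' = s
      · subst h
        exact ⟨1, by simp⟩
      · exact ⟨0, by simp [h]⟩
    · rw [← hsymm, ← toStandard_smul, (toStandard_eq_zero_iff hreg _).2, map_zero]
      intro s'
      by_cases h : s' = s
      · subst h
        simp
      · simp [h]
    · rw [hsum, map_eq_zero_iff _ φ.symm.injective] at hp
      exact (toStandard_eq_zero_iff hreg p).1 hp
    · obtain ⟨p, hp⟩ := toStandard_surjective (φ v)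
      exact ⟨p, by rw [hsum, hp, AddEquiv.symm_apply_apply]⟩
  · rintro ⟨g, hg⟩
    let Ψ : (SummandIndex r α α' → (ResidueField A)[X]) →+ TangentCone A :=
      { toFun := fun p => ∑ s, aeval (mulInitial hx) (p s) (g s)
        map_zero' := by simp
        map_add' := by simp [Finset.sum_add_distrib] }
    have hker : ∀ p, Ψ p = 0 ↔ ∀ s, SummandIndex.ann (ResidueField A) s ∣ p s := by
      intro p
      refine ⟨hg.dvd p, fun h => Finset.sum_eq_zero fun s _ => ?_⟩
      obtain ⟨q, hq⟩ := h s
      rw [hq, mul_comm, map_mul, Module.End.mul_apply, hg.annihilates, map_zero]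
    obtain ⟨φ, hφ⟩ := exists_addEquiv_of_ker_eq Ψ (toStandard x r α α') hg.span
      toStandard_surjective (by
        ext p
        rw [AddMonoidHom.mem_ker, AddMonoidHom.mem_ker, hker, toStandard_eq_zero_iff hreg])
    have hmon : ∀ n p, IsMonomialVector n p → Ψ p ∈ degree (maximalIdeal A) n := by
      intro n p hp
      change ∑ s, aeval (mulInitial hx) (p s) (g s) ∈ piece (maximalIdeal A) n
      refine Submodule.sum_mem _ fun s _ => ?_
      obtain ⟨c, hc⟩ := hp s
      rw [hc]
      split_ifs with h
      · rw [aeval_monomial, Module.End.mul_apply, Module.algebraMap_end_apply]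
        exact Submodule.smul_mem _ _ (pow_sub_apply_mem (mulInitial_mem hx) h (hg.mem s))
      · simp
    refine ⟨φ, fun f v => ?_, fun n v => ?_⟩
    · obtain ⟨q, rfl⟩ := aeval_xStar_surjective f
      obtain ⟨p, rfl⟩ : ∃ p, Ψ p = v := hg.span v
      rw [hφ, ← toStandard_smul, ← hφ, ← aeval_mulInitial]
      congr 1
      change aeval (mulInitial hx) q (∑ s, aeval (mulInitial hx) (p s) (g s)) =
        ∑ s, aeval (mulInitial hx) (q * p s) (g s)
      rw [map_sum]
      exact Finset.sum_congr rfl fun s _ => by rw [map_mul, Module.End.mul_apply]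
    · rw [isHomogeneous_iff]
      constructor
      · intro hv
        obtain ⟨p, rfl⟩ : ∃ p, Ψ p = v := hg.span v
        have h1 := isGradedProjection_proj.sum_aeval (mulInitial_mem hx) hg.mem p n
        have h2 := isGradedProjection_proj.self n _ hv
        -- A homogeneous element equals its own projection, so in each `p s` only the monomial of
        -- degree `n - s.deg` is needed.
        refine ⟨fun s => if s.deg ≤ n then monomial (n - s.deg) ((p s).coeff (n - s.deg)) else 0,
          fun s => ⟨_, rfl⟩, ?_⟩
        rw [← hφ]
        congr 1
        refine Eq.trans ?_ (h1.symm.trans h2)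
        rw [Finset.sum_filter]
        refine Finset.sum_congr rfl fun s _ => ?_
        dsimp only
        split_ifs with h
        · rw [aeval_monomial, Module.End.mul_apply, Module.algebraMap_end_apply]
        · rw [map_zero, LinearMap.zero_apply]
      · rintro ⟨p, hp, hpv⟩
        rw [← hφ, φ.injective.eq_iff] at hpv
        exact hpv ▸ hmon n p hp

end NoetherNormalization

/-! ### Lengths of ideal quotients and the Apery invariant. -/

section Length

variable {A : Type*} [CommRing A]

theorem quotLength_eq_of_surjective {I J : Ideal A} {P : Type*} [AddCommGroup P] [Module A P]
    (f : I →ₗ[A] P) (hf : Function.Surjective f) (hker : LinearMap.ker f = J.submoduleOf I) :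
    quotLength I J = Module.length A P :=
  ((Submodule.quotEquivOfEq _ _ hker.symm).trans (f.quotKerEquivOfSurjective hf)).length_eq

theorem quotLength_eq_add {I J K : Ideal A} (hKJ : K ≤ J) (hJI : J ≤ I) :
    quotLength I K = quotLength I J + quotLength J K := by
  have hle : K.submoduleOf I ≤ J.submoduleOf I := Submodule.comap_mono hKJ
  let f : (J ⧸ K.submoduleOf J) →ₗ[A] (I ⧸ K.submoduleOf I) :=
    Submodule.mapQ _ _ (Submodule.inclusion hJI) fun _ h => h
  let g : (I ⧸ K.submoduleOf I) →ₗ[A] (I ⧸ J.submoduleOf I) := Submodule.factor hle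
  rw [add_comm]
  refine Module.length_eq_add_of_exact f g ?_ (Submodule.factor_surjective hle) ?_
  · rw [← LinearMap.ker_eq_bot, LinearMap.ker_eq_bot']
    intro y hy
    induction y using Submodule.Quotient.induction_on with
    | H a =>
      have h : (Submodule.Quotient.mk (Submodule.inclusion hJI a) : I ⧸ K.submoduleOf I) = 0 := hy
      rw [Submodule.Quotient.mk_eq_zero] at h ⊢
      exact h
  · intro y
    induction y using Submodule.Quotient.induction_on with
    | H a =>
      have h : g (Submodule.Quotient.mk a) = Submodule.Quotient.mk a := rfl
      rw [h, Submodule.Quotient.mk_eq_zero]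
      constructor
      · intro ha
        exact ⟨Submodule.Quotient.mk ⟨a.1, ha⟩, rfl⟩
      · rintro ⟨z, hz⟩
        induction z using Submodule.Quotient.induction_on with
        | H b =>
          have h' : (Submodule.Quotient.mk (Submodule.inclusion hJI b) : I ⧸ K.submoduleOf I) =
            Submodule.Quotient.mk a := hz
          rw [Submodule.Quotient.eq] at h'
          have h2 : (b : A) - a ∈ J := hKJ h'
          exact (Submodule.sub_mem_iff_right J b.2).1 h2

theorem quotLength_sup_eq {I J : Ideal A} : quotLength (I ⊔ J) J = quotLength I (I ⊓ J) := by
  unfold quotLength Submodule.submoduleOf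
  rw [Submodule.comap_inf]
  exact (LinearMap.quotientInfEquivSupQuotient I J).length_eq.symm

/-- Length is additive along `x𝔪^(i-1) + 𝔪^(i+1) ⊆ (𝔪^i ∩ xA) + 𝔪^(i+1) ⊆ 𝔪^i`. The upper quotient
has length `γ_i` by the second isomorphism theorem, since the modular law identifies its denominator
with `𝔪^i ∩ (xA + 𝔪^(i+1))`. -/
theorem aperyInvariant_add_eq [IsLocalRing A] (x : A) {i : ℕ} (hi : 1 ≤ i)
    (hx : Ideal.span {x} ≤ maximalIdeal A) :
    aperyInvariant x i + quotLength ((maximalIdeal A ^ i ⊓ Ideal.span {x}) ⊔ maximalIdeal A ^ (i + 1))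
      (Ideal.span {x} * maximalIdeal A ^ (i - 1) ⊔ maximalIdeal A ^ (i + 1)) =
    quotLength (maximalIdeal A ^ i)
      (Ideal.span {x} * maximalIdeal A ^ (i - 1) ⊔ maximalIdeal A ^ (i + 1)) := by
  have hle : maximalIdeal A ^ (i + 1) ≤ maximalIdeal A ^ i := Ideal.pow_le_pow_right (Nat.le_succ i)
  have h1 : aperyInvariant x i = quotLength (maximalIdeal A ^ i)
      ((maximalIdeal A ^ i ⊓ Ideal.span {x}) ⊔ maximalIdeal A ^ (i + 1)) := by
    have h := quotLength_sup_eq (I := maximalIdeal A ^ i)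
      (J := maximalIdeal A ^ (i + 1) ⊔ Ideal.span {x})
    rw [← sup_assoc, sup_eq_left.2 hle] at h
    rw [aperyInvariant, h, sup_comm (maximalIdeal A ^ (i + 1)), ← inf_sup_assoc_of_le _ hle]
  have h2 : Ideal.span {x} * maximalIdeal A ^ (i - 1) ≤ maximalIdeal A ^ i := by
    obtain ⟨m, rfl⟩ := Nat.exists_eq_add_of_le' hi
    rw [pow_succ']
    exact Ideal.mul_mono_left hx
  have h3 : Ideal.span {x} * maximalIdeal A ^ (i - 1) ≤ Ideal.span {x} := Ideal.mul_le_left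
  rw [h1]
  exact (quotLength_eq_add (sup_le_sup_right (le_inf h2 h3) _) (sup_le inf_le_left hle)).symm

end Length

/-! ### Consequences of `𝔪^(r+1) = x𝔪^r` for multiplication by the initial form. -/

section TangentCone

open FiberCone

variable {A : Type*} [CommRing A] [IsLocalRing A] {x : A}

theorem maximalIdeal_mul_pow (n : ℕ) :
    maximalIdeal A * maximalIdeal A ^ n = maximalIdeal A ^ (n + 1) := (pow_succ' _ n).symm

theorem pow_succ_eq_of_le {r : ℕ}
    (hr : maximalIdeal A ^ (r + 1) = Ideal.span {x} * maximalIdeal A ^ r) {n : ℕ} (hn : r ≤ n) :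
    maximalIdeal A ^ (n + 1) = Ideal.span {x} * maximalIdeal A ^ n := by
  obtain ⟨d, rfl⟩ := Nat.exists_eq_add_of_le hn
  rw [add_right_comm, pow_add, hr, pow_add, mul_assoc]

theorem mem_pow_of_mul_mem {r : ℕ} (hreg : x ∈ nonZeroDivisors A)
    (hr : maximalIdeal A ^ (r + 1) = Ideal.span {x} * maximalIdeal A ^ r) {n : ℕ} (hn : r ≤ n)
    {a : A} (ha : a * x ∈ maximalIdeal A ^ (n + 1)) : a ∈ maximalIdeal A ^ n := by
  rw [pow_succ_eq_of_le hr hn, Ideal.mem_span_singleton_mul] at ha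
  obtain ⟨b, hb, hba⟩ := ha
  rw [mul_comm, mul_cancel_right_mem_nonZeroDivisors hreg] at hba
  exact hba ▸ hb

variable (hx : Ideal.span {x} ≤ maximalIdeal A)

/-- Vanishing in degree `n + 1` means `a * x ∈ 𝔪^(n+2) = x𝔪^(n+1)`, which needs only `r ≤ n + 1`.
Injectivity thus begins in degree `r - 1`, one degree before surjectivity; this is what excludes
torsion of order `r - i` in degree `i`. -/
theorem mulInitial_injective {r : ℕ} (hreg : x ∈ nonZeroDivisors A)
    (hr : maximalIdeal A ^ (r + 1) = Ideal.span {x} * maximalIdeal A ^ r) {n : ℕ} (hn : r ≤ n + 1) :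
    ∀ v ∈ piece (maximalIdeal A) n, mulInitial hx v = 0 → v = 0 := by
  intro v hv h
  obtain ⟨a, ha, rfl⟩ := mem_piece_iff.1 hv
  rw [mulInitial_cls, cls_eq_zero_iff, maximalIdeal_mul_pow] at h
  rw [cls_eq_zero_iff, maximalIdeal_mul_pow]
  exact mem_pow_of_mul_mem hreg hr hn h

theorem mulInitial_surjective {r : ℕ}
    (hr : maximalIdeal A ^ (r + 1) = Ideal.span {x} * maximalIdeal A ^ r) {n : ℕ} (hn : r ≤ n) :
    piece (maximalIdeal A) (n + 1) ≤ (piece (maximalIdeal A) n).map (mulInitial hx) := by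
  intro v hv
  obtain ⟨a, ha, rfl⟩ := mem_piece_iff.1 hv
  have ha' := ha
  rw [pow_succ_eq_of_le hr hn, Ideal.mem_span_singleton_mul] at ha'
  obtain ⟨b, hb, rfl⟩ := ha'
  refine ⟨cls _ n b hb, cls_mem_piece hb, ?_⟩
  rw [mulInitial_cls]
  exact cls_congr _ rfl (mul_comm _ _)

/-- Otherwise `𝔪^(r+j) = x^j 𝔪^r ⊆ 𝔪^(r+j+1)`, so `𝔪^(r+j) = 0` by Nakayama, although it contains
the nonzerodivisor `x^(r+j)`. -/
theorem pow_notMem_pow_succ [IsNoetherianRing A] {r : ℕ} (hreg : x ∈ nonZeroDivisors A)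
    (hx : Ideal.span {x} ≤ maximalIdeal A)
    (hr : maximalIdeal A ^ (r + 1) = Ideal.span {x} * maximalIdeal A ^ r) (j : ℕ) :
    x ^ j ∉ maximalIdeal A ^ (j + 1) := by
  intro h
  have hpow : maximalIdeal A ^ (r + j) ≤ maximalIdeal A ^ (r + j + 1) := by
    have h1 : ∀ d, maximalIdeal A ^ (r + d) = Ideal.span {x ^ d} * maximalIdeal A ^ r := by
      intro d
      induction d with
      | zero => simp
      | succ d ih =>
        rw [← add_assoc, pow_succ_eq_of_le hr (Nat.le_add_right r d), ih, ← mul_assoc,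
          Ideal.span_singleton_mul_span_singleton, pow_succ']
    rw [h1 j, add_assoc, add_comm, pow_add]
    exact Ideal.mul_mono_left ((Ideal.span_singleton_le_iff_mem _).2 h)
  have hbot : maximalIdeal A ^ (r + j) = ⊥ := by
    refine Submodule.eq_bot_of_le_smul_of_le_jacobson_bot (maximalIdeal A) _
      (IsNoetherian.noetherian _) ?_ (maximalIdeal_le_jacobson ⊥)
    rwa [smul_eq_mul, maximalIdeal_mul_pow]
  have hmem : x ^ (r + j) ∈ maximalIdeal A ^ (r + j) :=
    Ideal.pow_mem_pow (hx (Ideal.mem_span_singleton_self x)) _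
  rw [hbot] at hmem
  exact nonZeroDivisors.ne_zero (pow_mem hreg (r + j)) hmem

/-- A nonzero class of degree zero is represented by a unit. This is why torsion summands start at
`i = 1`. -/
theorem mulInitial_pow_injective_zero [IsNoetherianRing A] {r : ℕ} (hreg : x ∈ nonZeroDivisors A)
    (hr : maximalIdeal A ^ (r + 1) = Ideal.span {x} * maximalIdeal A ^ r) (j : ℕ) :
    ∀ v ∈ piece (maximalIdeal A) 0, (mulInitial hx ^ j) v = 0 → v = 0 := by
  intro v hv h
  obtain ⟨a, ha, rfl⟩ := mem_piece_iff.1 hv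
  rw [mulInitial_pow_cls, cls_eq_zero_iff, maximalIdeal_mul_pow, zero_add] at h
  rw [cls_eq_zero_iff, maximalIdeal_mul_pow, zero_add, pow_one]
  by_contra hu
  rw [mem_maximalIdeal, mem_nonunits_iff, not_not] at hu
  exact pow_notMem_pow_succ hreg hx hr j ((Ideal.unit_mul_mem_iff_mem _ hu).1 h)

theorem cls_mem_prevImage_iff {i : ℕ} (hi : 1 ≤ i) {a : A} (ha : a ∈ maximalIdeal A ^ i) :
    cls _ i a ha ∈ prevImage (mulInitial hx) (piece (maximalIdeal A)) i ↔
      a ∈ Ideal.span {x} * maximalIdeal A ^ (i - 1) ⊔ maximalIdeal A ^ (i + 1) := by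
  obtain ⟨m, rfl⟩ := Nat.exists_eq_add_of_le' hi
  rw [Nat.add_sub_cancel, Submodule.mem_sup]
  constructor
  · rintro ⟨u, hu, h⟩
    obtain ⟨b, hb, rfl⟩ := mem_piece_iff.1 hu
    have hbx := mul_mem_pow hb (mem_maximalIdeal_of_span_le hx)
    refine ⟨x * b, Ideal.mul_mem_mul (Ideal.mem_span_singleton_self x) hb, a - b * x, ?_, by ring⟩
    rw [← maximalIdeal_mul_pow, ← cls_eq_zero_iff (sub_mem ha hbx)]
    have h1 := cls_add (sub_mem ha hbx) hbx
    rw [mulInitial_cls] at h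
    rw [h] at h1
    have h2 := cls_congr (I := maximalIdeal A) (ha := add_mem (sub_mem ha hbx) hbx) ha rfl
      (sub_add_cancel a (b * x))
    rw [h1] at h2
    simpa using h2
  · rintro ⟨y, hy, z, hz, rfl⟩
    obtain ⟨b, hb, rfl⟩ := Ideal.mem_span_singleton_mul.1 hy
    refine ⟨cls _ m b hb, cls_mem_piece hb, ?_⟩
    have hxb : x * b ∈ maximalIdeal A ^ (m + 1) := by
      rw [mul_comm]
      exact mul_mem_pow hb (mem_maximalIdeal_of_span_le hx)
    have hz' : z ∈ maximalIdeal A ^ (m + 1) := Ideal.pow_le_pow_right (Nat.le_succ _) hz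
    rw [mulInitial_cls, cls_add hxb hz', (cls_eq_zero_iff hz').2 (by rwa [maximalIdeal_mul_pow]),
      add_zero]
    exact cls_congr _ rfl (mul_comm _ _)

theorem quotLength_eq_card {ι : Type*} [Fintype ι] {deg : ι → ℕ}
    {q : ι → Polynomial (ResidueField A)} {g : ι → TangentCone A}
    (h : IsCyclicDecomposition (mulInitial hx) (piece (maximalIdeal A)) deg q g)
    (hq : ∀ s, Polynomial.X ∣ q s) {i : ℕ} (hi : 1 ≤ i) :
    quotLength (maximalIdeal A ^ i)
      (Ideal.span {x} * maximalIdeal A ^ (i - 1) ⊔ maximalIdeal A ^ (i + 1)) =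
        Nat.card {s // deg s = i} := by
  classical
  obtain ⟨η, hη, hker⟩ := h.exists_coordinates isGradedProjection_proj (mulInitial_mem hx) hq i
  rw [quotLength_eq_of_surjective (η.restrictScalars A ∘ₗ clsMap (maximalIdeal A) i)
    (hη.comp (clsMap_surjective i)),
    -- Length over `A` equals dimension over the residue field because `A` surjects onto it.
    Module.length_eq_of_surjective (R := ResidueField A) residue_surjective,
    Module.length_eq_finrank, Module.finrank_fintype_fun_eq_card, Nat.card_eq_fintype_card]
  ext a
  have h1 : a ∈ LinearMap.ker (η.restrictScalars A ∘ₗ clsMap (maximalIdeal A) i) ↔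
    clsMap (maximalIdeal A) i a ∈ LinearMap.ker η := Iff.rfl
  rw [h1, hker]
  exact cls_mem_prevImage_iff hx hi a.2

end TangentCone

/-! ### Regularity of `x`, and the theorem. -/

theorem mem_nonZeroDivisors_of_isCohenMacaulayLocal {A : Type*} [CommRing A] [IsLocalRing A]
    (hCM : IsCohenMacaulayLocal A) (hdim : ringKrullDim A = 1) {x : A}
    (hx : IsReduction (maximalIdeal A) (Ideal.span {x})) : x ∈ nonZeroDivisors A := by
  obtain ⟨rs, hmem, hreg, hlen⟩ := hCM
  rw [hdim] at hlen
  obtain ⟨a, rfl⟩ := List.length_eq_one_iff.1 (by exact_mod_cast hlen : rs.length = 1)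
  have ha : IsSMulRegular A a := ((RingTheory.Sequence.isRegular_cons_iff A a []).1 hreg).1
  obtain ⟨-, n, hn⟩ := hx
  -- The regular element `a ∈ 𝔪` has a power in `𝔪^(n+1) = x𝔪^n`, so `x` divides a nonzerodivisor.
  have hpow : a ^ (n + 1) ∈ Ideal.span {x} := by
    have h1 := Ideal.pow_mem_pow (hmem a (List.mem_singleton_self a)) (n + 1)
    rw [hn] at h1
    exact Ideal.mul_le_left h1
  obtain ⟨b, hb⟩ := Ideal.mem_span_singleton'.1 hpow
  rw [mem_nonZeroDivisors_iff_right]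
  intro z hz
  apply ha.pow (n + 1)
  simp only [smul_eq_mul, mul_zero]
  rw [← hb, mul_assoc, mul_comm x z, hz, mul_zero]

theorem mainTheorem6 {A : Type*} [CommRing A] [IsLocalRing A] [IsNoetherianRing A]
    [Infinite (IsLocalRing.ResidueField A)]
    (hCM : IsCohenMacaulayLocal A) (hdim : ringKrullDim A = 1)
    (x : A) (hx : IsMinimalReduction (IsLocalRing.maximalIdeal A) (Ideal.span {x})) :
    (∃ (α : ℕ → ℕ) (α' : ℕ → ℕ → ℕ), IsTangentConeInvariants x hx.prop.1 α α') ∧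
    ∀ (α : ℕ → ℕ) (α' : ℕ → ℕ → ℕ), IsTangentConeInvariants x hx.prop.1 α α' →
      ∀ i : ℕ, 1 ≤ i → i ≤ reductionNumber (IsLocalRing.maximalIdeal A) (Ideal.span {x}) →
        ((α i + ∑ j ∈ Finset.Icc 1
            (reductionNumber (IsLocalRing.maximalIdeal A) (Ideal.span {x}) - i - 1), α' i j : ℕ) :
              ℕ∞) =
          aperyInvariant x i +
            quotLength
              ((IsLocalRing.maximalIdeal A ^ i ⊓ Ideal.span {x}) ⊔
                IsLocalRing.maximalIdeal A ^ (i + 1))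
              (Ideal.span {x} * IsLocalRing.maximalIdeal A ^ (i - 1) ⊔
                IsLocalRing.maximalIdeal A ^ (i + 1)) := by
  set r := reductionNumber (IsLocalRing.maximalIdeal A) (Ideal.span {x})
  have hreg := mem_nonZeroDivisors_of_isCohenMacaulayLocal hCM hdim hx.prop
  -- The infimum is attained: the set is nonempty because `xA` is a reduction.
  have hr : maximalIdeal A ^ (r + 1) = Ideal.span {x} * maximalIdeal A ^ r :=
    Nat.sInf_mem (s := {n : ℕ | maximalIdeal A ^ (n + 1) = Ideal.span {x} * maximalIdeal A ^ n})
      hx.prop.2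
  refine ⟨?_, fun α α' hα i hi hir => ?_⟩
  · obtain ⟨α, α', hg⟩ := exists_isCyclicDecomposition
      FiberCone.isGradedProjection_proj (mulInitial_mem hx.prop.1)
      (fun n hn => mulInitial_surjective hx.prop.1 hr hn)
      (fun n hn => mulInitial_injective hx.prop.1 hreg hr (Nat.le_succ_of_le hn))
      (mulInitial_pow_injective_zero hx.prop.1 hreg hr) inferInstance
    exact ⟨α, α', (exists_iso_iff_exists_isCyclicDecomposition hx.prop.1 hreg).2 hg⟩
  · obtain ⟨g, hg⟩ := (exists_iso_iff_exists_isCyclicDecomposition (r := r) hx.prop.1 hreg).1 hα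
    have hq : ∀ s : SummandIndex r α α', Polynomial.X ∣ SummandIndex.ann (ResidueField A) s := by
      rintro (s | t)
      · exact dvd_zero _
      · exact dvd_pow_self _ (by have := t.1.2.2.1; omega)
    rw [aperyInvariant_add_eq x hi hx.prop.1, quotLength_eq_card hx.prop.1 hg hq hi,
      Nat.card_eq_fintype_card, card_deg_eq hi hir]
    intro hir'
    by_contra hne
    -- If `α' i (r - i)` were nonzero, its first copy would be a generator of degree `i` with
    -- annihilator `X ^ (r - i)`, so that degree and order add up to `r`.
    exact hg.ne_of_injective (mulInitial_mem hx.prop.1)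
      (fun n hn => mulInitial_injective hx.prop.1 hreg hr hn)
      (s := Sum.inr ⟨⟨(i, r - i), ⟨hi, by simp only; omega⟩, by simp only; omega, le_rfl⟩,
        ⟨0, Nat.pos_of_ne_zero hne⟩⟩) (j := r - i) (by omega) rfl (by
          change i + (r - i) = r
          omega)

end
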